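/- All graphs are finite and labeled. A graph class $\mathcal{G}$ is a set of graphs closed under isomorphism; we consider both classes of general graphs and classes of bipartite graphs $G=(X,Y,E)$ with a fixed bipartition (closed under isomorphisms respecting the bipartition). **Sign-rank.** Put $\operatorname{sign}(r)=1$ if $r\ge 0$ and $\operatorname{sign}(r)=-1$ otherwise. For a bipartite graph $G=(X,Y,E)$ with a fixed bipartition, let $\mathrm{Adj}_G\in\{\pm1\}^{X\times Y}$ have entry $1$ at $(x,y)$ if $xy\in E$ and $-1$ otherwise; the sign-rank of $G$ is the minimum rank of a real matrix $R\in\mathbb{R}^{X\times Y}$ with $\operatorname{sign}(R(x,y))=\mathrm{Adj}_G(x,y)$ for all $x,y$. For a general graph $G=(V,E)$, let $\mathrm{Adj}_G\in\{\pm1\}^{V\times V}$ have entry $1$ at $(x,y)$ if $xy\in E$ and $-1$ otherwise; the sign-rank of $G$ is the minimum rank of a real matrix $R\in\mathbb{R}^{V\times V}$ with $\operatorname{sign}(R(x,y))=\mathrm{Adj}_G(x,y)$ for all $x\ne y$ (no condition on the diagonal). A class has sign-rank at most $3$ if each of its graphs does. **Equality oracles.** Let $\mathrm{QS}(\mathrm{Eq})$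 be the smallest set of $\pm1$ matrices that contains all identity matrices (entries $1$ on the diagonal and $-1$ off it) and is closed under row and column permutations, taking submatrices, and duplicating a row or a column. A deterministic protocol with $\mathrm{Eq}$ oracles computing $P\in\{\pm1\}^{X\times Y}$ is a rooted binary tree in which each inner node $v$ carries an $X\times Y$ matrix $Q_v\in\mathrm{QS}(\mathrm{Eq})$ and each leaf carries a value in $\{\pm1\}$, such that for every $(x,y)\in X\times Y$ the walk that starts at the root and moves from $v$ to its left child if $Q_v(x,y)=-1$ and to its right child if $Q_v(x,y)=1$ ends at a leaf with value $P(x,y)$. $\mathsf{D}^{\mathrm{Eq}}(P)$ is the minimum depth of such a tree, and $\mathsf{D}^{\mathrm{Eq}}(\mathcal{G})$ is the function $N\mapsto\max\{\mathsf{D}^{\mathrm{Eq}}(\mathrm{Adj}_G) : G\in\mathcal{G}\text{ has } N\text{ vertices}\}$. We write $\mathsf{D}^{\mathrm{Eq}}(\mathcal{G})=O(1)$ if this function is bounded by a constant. **Stability.** The chain-index $\mathrm{ch}(G)$ is the largest $k$ for which there are disjoint sets of $k$ vertices each, $\{a_1,\dots,a_k\}$ and $\{b_1,\dots,b_k\}$,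 such that for all $i<j$ the vertices $a_i,b_j$ are adjacent and $b_i,a_j$ are not. A class $\mathcal{G}$ is stable if there is a constant $k$ with $\mathrm{ch}(G)\le k$ for all $G\in\mathcal{G}$. **Theorem.** Let $\mathcal{G}$ be a graph class (of general graphs, or of bipartite graphs with a fixed bipartition) with sign-rank at most $3$. Then $\mathsf{D}^{\mathrm{Eq}}(\mathcal{G})=O(1)$ if and only if $\mathcal{G}$ is stable. -/

import Mathlib

/-!
Sign matrices have entries in `ℤˣ = {1, -1}`. Graphs are finite and labeled: the vertex set of an
`N`-vertex graph is `Fin N`, and the sides of a bipartite graph with a fixed bipartition are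
`Fin m` and `Fin n`. Minima and maxima that define complexity measures are taken in `ℕ∞`, so that
no default value can intervene.
-/

namespace SignRankGraphs

/-! ### Sign-rank -/

/-- The sign of a real number, with the convention `sgn 0 = 1`: a point on the boundary of the
closed halfspace `{p | 0 ≤ ⟪p, h⟫}` belongs to it. -/
noncomputable def sgn (r : ℝ) : ℤˣ := if 0 ≤ r then 1 else -1

/-- The sign-rank of a sign matrix `M`: the minimum rank of a real matrix `R` with `M = sgn R`. -/
noncomputable def signRank {X Y : Type*} [Fintype Y] (M : Matrix X Y ℤˣ) : ℕ∞ :=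
  ⨅ (R : Matrix X Y ℝ) (_ : ∀ x y, sgn (R x y) = M x y), (R.rank : ℕ∞)

/-- The sign-rank of a partial sign matrix; the entry `none` is the symbol `⋆`, which imposes no
condition. -/
noncomputable def partialSignRank {X Y : Type*} [Fintype Y] (A : Matrix X Y (Option ℤˣ)) : ℕ∞ :=
  ⨅ (R : Matrix X Y ℝ) (_ : ∀ x y s, A x y = some s → sgn (R x y) = s), (R.rank : ℕ∞)

/-! ### Graphs, adjacency matrices, chain-index -/

/-- A bipartite graph `(X, Y, E)` with a fixed bipartition. -/
@[ext]
structure BipartiteGraph (X Y : Type*) where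
  /-- adjacency between the two sides -/
  Adj : X → Y → Prop

/-- The underlying graph, on the disjoint union of the two sides. -/
def BipartiteGraph.toSimpleGraph {X Y : Type*} (G : BipartiteGraph X Y) : SimpleGraph (X ⊕ Y) where
  Adj u v := (∃ x y, u = Sum.inl x ∧ v = Sum.inr y ∧ G.Adj x y) ∨
    (∃ x y, u = Sum.inr y ∧ v = Sum.inl x ∧ G.Adj x y)
  symm := ⟨by
    rintro u v (⟨x, y, hu, hv, h⟩ | ⟨x, y, hu, hv, h⟩)
    · exact Or.inr ⟨x, y, hv, hu, h⟩
    · exact Or.inl ⟨x, y, hv, hu, h⟩⟩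
  loopless := ⟨by
    rintro u (⟨x, y, hu, hv, -⟩ | ⟨x, y, hu, hv, -⟩) <;> subst hu <;> cases hv⟩

open Classical in
/-- The adjacency matrix of a graph, with entry `1` for adjacent pairs and `-1` otherwise
(in particular `-1` on the diagonal). -/
noncomputable def adjacency {V : Type*} (G : SimpleGraph V) : Matrix V V ℤˣ :=
  fun x y => if G.Adj x y then 1 else -1

open Classical in
/-- The partial adjacency matrix of a graph, with `⋆` on the diagonal. -/
noncomputable def partialAdjacency {V : Type*} (G : SimpleGraph V) : Matrix V V (Option ℤˣ) :=
  fun x y => if x = y then none else if G.Adj x y then some 1 else some (-1)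

open Classical in
/-- The bipartite adjacency matrix: rows are indexed by `X`, columns by `Y`. -/
noncomputable def BipartiteGraph.adjacency {X Y : Type*} (G : BipartiteGraph X Y) :
    Matrix X Y ℤˣ :=
  fun x y => if G.Adj x y then 1 else -1

/-- There are disjoint sets `{a_1, …, a_k}`, `{b_1, …, b_k}` of `k` vertices each such that for
all `i < j` the vertices `a_i, b_j` are adjacent and `b_i, a_j` are not. -/
def HasChain {V : Type*} (G : SimpleGraph V) (k : ℕ) : Prop :=
  ∃ a b : Fin k → V, Function.Injective a ∧ Function.Injective b ∧
    Disjoint (Set.range a) (Set.range b) ∧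
    ∀ i j : Fin k, i < j → G.Adj (a i) (b j) ∧ ¬ G.Adj (b i) (a j)

/-- The chain-index: the largest `k` for which a chain as above exists. -/
noncomputable def chainIndex {V : Type*} (G : SimpleGraph V) : ℕ∞ :=
  ⨆ (k : ℕ) (_ : HasChain G k), (k : ℕ∞)

/-! ### Query sets and protocols with oracles -/

/-- A set of sign matrices of arbitrary finite sizes. -/
abbrev MatrixSet : Type := ∀ m n : ℕ, Set (Matrix (Fin m) (Fin n) ℤˣ)

/-- `QS 𝓑`: the closure of a set `𝓑` of matrices under row and column permutations, submatrices,
and duplication of a row or of a column. -/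
inductive QS (𝓑 : MatrixSet) : ∀ {m n : ℕ}, Matrix (Fin m) (Fin n) ℤˣ → Prop
  | base {m n : ℕ} {Q : Matrix (Fin m) (Fin n) ℤˣ} : Q ∈ 𝓑 m n → QS 𝓑 Q
  | perm {m n : ℕ} {Q : Matrix (Fin m) (Fin n) ℤˣ}
      (σ : Equiv.Perm (Fin m)) (τ : Equiv.Perm (Fin n)) :
      QS 𝓑 Q → QS 𝓑 (Q.submatrix σ τ)
  | sub {m n k l : ℕ} {Q : Matrix (Fin m) (Fin n) ℤˣ}
      (f : Fin k ↪o Fin m) (g : Fin l ↪o Fin n) :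
      QS 𝓑 Q → QS 𝓑 (Q.submatrix f g)
  | dupRow {m n : ℕ} {Q : Matrix (Fin m) (Fin n) ℤˣ} (r : Fin m) :
      QS 𝓑 Q → QS 𝓑 (m := m + 1) (Q.submatrix (Fin.cons r id) id)
  | dupCol {m n : ℕ} {Q : Matrix (Fin m) (Fin n) ℤˣ} (c : Fin n) :
      QS 𝓑 Q → QS 𝓑 (n := n + 1) (Q.submatrix id (Fin.cons c id))

/-- The Equality problem: all identity matrices (`1` on the diagonal, `-1` off it). -/
def Equality : MatrixSet := fun m n =>
  {M | m = n ∧ ∀ (i : Fin m) (j : Fin n), M i j = if (i : ℕ) = (j : ℕ) then 1 else -1}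

/-- A rooted binary tree whose leaves carry values in `{1, -1}` and whose inner nodes carry sign
matrices. The arguments of `node` are the matrix, the left child and the right child. -/
inductive Protocol (m n : ℕ) : Type
  | leaf (b : ℤˣ) : Protocol m n
  | node (Q : Matrix (Fin m) (Fin n) ℤˣ) (left right : Protocol m n) : Protocol m n

namespace Protocol

variable {m n : ℕ}

/-- The output on the inputs `x, y`: at an inner node with matrix `Q`, go to the left child if
`Q x y = -1` and to the right child if `Q x y = 1`; at a leaf, output its value. -/
def output : Protocol m n → Fin m → Fin n → ℤˣ
  | leaf b, _, _ => b
  | node Q left right, x, y => if Q x y = -1 then left.output x y else right.output x y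

/-- The depth of the tree, i.e. the largest number of inner nodes on a root-to-leaf path. -/
def depth : Protocol m n → ℕ
  | leaf _ => 0
  | node _ left right => max left.depth right.depth + 1

/-- Every inner node carries a matrix from `QS 𝓑`. -/
def UsesOracle (𝓑 : MatrixSet) : Protocol m n → Prop
  | leaf _ => True
  | node Q left right => QS 𝓑 Q ∧ left.UsesOracle 𝓑 ∧ right.UsesOracle 𝓑

end Protocol

/-- `D^𝓑(P)`: the minimum cost (depth) of a deterministic protocol with `𝓑` oracles that computes
`P`. -/
noncomputable def oracleCost (𝓑 : MatrixSet) {m n : ℕ} (P : Matrix (Fin m) (Fin n) ℤˣ) : ℕ∞ :=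
  ⨅ (T : Protocol m n) (_ : T.UsesOracle 𝓑 ∧ ∀ x y, T.output x y = P x y), (T.depth : ℕ∞)

/-! ### Classes of graphs -/

/-- A class of (finite, labeled) graphs: a set of graphs closed under isomorphism. -/
structure GraphClass where
  /-- the graphs of the class on `N` vertices -/
  graphs : ∀ N : ℕ, Set (SimpleGraph (Fin N))
  iso_closed : ∀ {N : ℕ} {G H : SimpleGraph (Fin N)},
    G ∈ graphs N → Nonempty (G ≃g H) → H ∈ graphs N

/-- A class of (finite, labeled) bipartite graphs with a fixed bipartition: a set of such graphs
closed under the isomorphisms that respect the bipartitions. -/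
structure BipartiteGraphClass where
  /-- the graphs of the class with sides of sizes `m` and `n` -/
  graphs : ∀ m n : ℕ, Set (BipartiteGraph (Fin m) (Fin n))
  iso_closed : ∀ {m n : ℕ} {G H : BipartiteGraph (Fin m) (Fin n)}
    (e : Fin m ≃ Fin m) (f : Fin n ≃ Fin n),
    G ∈ graphs m n → (∀ x y, G.Adj x y ↔ H.Adj (e x) (f y)) → H ∈ graphs m n

/-- The claim `c(N) = O(1)` for a complexity measure `c`. -/
def IsConstantCost (c : ℕ → ℕ∞) : Prop := ∃ C : ℕ, ∀ N, c N ≤ C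

namespace GraphClass

/-- All graphs of the class have sign-rank at most `d` (no condition on diagonal entries). -/
def SignRankAtMost (𝒢 : GraphClass) (d : ℕ) : Prop :=
  ∀ N, ∀ G ∈ 𝒢.graphs N, partialSignRank (partialAdjacency G) ≤ d

/-- The chain-index is bounded on the class. -/
def Stable (𝒢 : GraphClass) : Prop :=
  ∃ k : ℕ, ∀ N, ∀ G ∈ 𝒢.graphs N, chainIndex G ≤ k

/-- `D^Eq(𝒢)`, the function that maps `N` to the maximum of `D^Eq(Adj_G)` over the graphs of the
class with `N` vertices. -/
noncomputable def equalityCost (𝒢 : GraphClass) (N : ℕ) : ℕ∞ :=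
  ⨆ G ∈ 𝒢.graphs N, oracleCost Equality (adjacency G)

end GraphClass

namespace BipartiteGraphClass

/-- The bipartite adjacency matrices of all graphs of the class have sign-rank at most `d`. -/
def SignRankAtMost (𝒢 : BipartiteGraphClass) (d : ℕ) : Prop :=
  ∀ m n, ∀ G ∈ 𝒢.graphs m n, signRank G.adjacency ≤ d

/-- The chain-index is bounded on the class. -/
def Stable (𝒢 : BipartiteGraphClass) : Prop :=
  ∃ k : ℕ, ∀ m n, ∀ G ∈ 𝒢.graphs m n, chainIndex G.toSimpleGraph ≤ k

/-- `D^Eq(𝒢)`, the function that maps `N` to the maximum of `D^Eq(Adj_G)` over the graphs of the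
class with `N` vertices, where `Adj_G` is the bipartite adjacency matrix. -/
noncomputable def equalityCost (𝒢 : BipartiteGraphClass) (N : ℕ) : ℕ∞ :=
  ⨆ (m : ℕ) (n : ℕ) (_ : m + n = N), ⨆ G ∈ 𝒢.graphs m n, oracleCost Equality G.adjacency

end BipartiteGraphClass

end SignRankGraphs

/-!
Both directions rest on half-graphs (chains).

If all costs are at most `d`, chains are short: a query `f x = g y` is constant on the off-diagonal
pairs of a large subset of a long chain (`exists_subset_homogeneous`), so after `d` queries some
pairs `(i, j)` and `(j, i)` still reach the same leaf, although the matrix separates them.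

For the converse, a real matrix `R` of rank at most `3` is split into nine blocks on each of which,
after positive scaling of rows and columns, `R x y = a x * v y + w y + c x`: points and halfplanes
in the plane. The only trace of the geometry that is used is that, when the rows are placed on a
line by `a` and the columns by `v`, the two edges of every induced matching are in the same order on
both sides (`OrderPreserving`, `orderPreserving_of_eq`).

Order-preserving bipartite graphs are then treated by induction on the length of the longest chain,
by means of a Gyárfás decomposition: a spanning forest in which every path to a root is induced and
in which any two adjacent vertices lie in bags (sets of siblings) one of which is an ancestor of the
other (`exists_isGyarfas`). If a vertex had neighbours in many bags above its own, the order
condition would force each of these neighbours to be adjacent to the later vertices, but not to the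
earlier ones, of the induced path that leads to the vertex, and this is a half-graph
(`exists_halfGraph`, `IsGyarfas.card_le`). So boundedly many equality queries suffice to find out
whether two vertices lie in a bag and in one of the relevant bags above it. Between a bag and the
vertices below it the chains are shorter, because any chain there is extended by the parent of the
bag and by the grandparent (`EqCompOn.of_isolated`). Roots have no parent; an isolated vertex `z`
that replaces it is obtained by splitting the rows according to an arbitrary column and taking the
complement on one of the two parts, which preserves both the order condition and the lengths of
chains (`exists_chainBound`).

In a general graph the diagonal is unconstrained. The protocol first asks whether `x = y`, and a
long chain in the matrix, whose rows and columns may share vertices, contains a long chain of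
disjoint vertices (`hasChain_of_hasChainOn`).
-/

/-! ### Predicates computed by equality queries -/

namespace SignRankGraphs

/-- `EqComp d M`: the predicate `M` is computed by a decision tree of depth `d` whose inner nodes
ask whether `f x = g y`, for arbitrary labellings `f` and `g`, and whose leaves carry a predicate
of `x` alone. Leaves of this kind, rather than constant ones, make the notion stable under running
a family of protocols in parallel (`EqComp.glue`). -/
def EqComp {X Y : Type} : ℕ → (X → Y → Prop) → Prop
  | 0, M => ∃ φ : X → Prop, ∀ x y, M x y ↔ φ x
  | d + 1, M => ∃ (T : Type) (f : X → T) (g : Y → T) (M₁ M₂ : X → Y → Prop),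
      EqComp d M₁ ∧ EqComp d M₂ ∧
        ∀ x y, M x y ↔ (f x = g y ∧ M₁ x y) ∨ (f x ≠ g y ∧ M₂ x y)

/-- `M` agrees on `A × B` with a predicate computed in depth `d`. -/
def EqCompOn {X Y : Type} (d : ℕ) (A : Set X) (B : Set Y) (M : X → Y → Prop) : Prop :=
  ∃ N : X → Y → Prop, EqComp d N ∧ ∀ x ∈ A, ∀ y ∈ B, (N x y ↔ M x y)

section EqComp

variable {X Y : Type}

theorem EqComp.node {d : ℕ} {T : Type} (f : X → T) (g : Y → T) {M₁ M₂ : X → Y → Prop}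
    (h₁ : EqComp d M₁) (h₂ : EqComp d M₂) :
    EqComp (d + 1) (fun x y => (f x = g y ∧ M₁ x y) ∨ (f x ≠ g y ∧ M₂ x y)) :=
  ⟨T, f, g, M₁, M₂, h₁, h₂, fun _ _ => Iff.rfl⟩

theorem EqComp.const (b : Prop) : EqComp 0 (fun (_ : X) (_ : Y) => b) :=
  ⟨fun _ => b, fun _ _ => Iff.rfl⟩

theorem EqComp.congr {d : ℕ} {M N : X → Y → Prop} (h : EqComp d M)
    (hMN : ∀ x y, N x y ↔ M x y) : EqComp d N := by
  have : N = M := by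
    funext x y
    exact propext (hMN x y)
  rwa [this]

theorem EqComp.succ {d : ℕ} {M : X → Y → Prop} (h : EqComp d M) : EqComp (d + 1) M :=
  (EqComp.node (fun _ => ()) (fun _ => ()) h h).congr fun x y => by simp

theorem EqComp.mono {d e : ℕ} {M : X → Y → Prop} (h : EqComp d M) (hde : d ≤ e) : EqComp e M := by
  induction hde with
  | refl => exact h
  | step _ ih => exact ih.succ

theorem EqCompOn.mono {d e : ℕ} {A : Set X} {B : Set Y} {M : X → Y → Prop}
    (h : EqCompOn d A B M) (hde : d ≤ e) : EqCompOn e A B M := by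
  obtain ⟨N, hN, hM⟩ := h
  exact ⟨N, hN.mono hde, hM⟩

theorem EqComp.not {d : ℕ} : ∀ {M : X → Y → Prop}, EqComp d M → EqComp d (fun x y => ¬ M x y) := by
  induction d with
  | zero =>
    rintro M ⟨φ, hφ⟩
    exact ⟨fun x => ¬ φ x, fun x y => not_congr (hφ x y)⟩
  | succ d ih =>
    rintro M ⟨T, f, g, M₁, M₂, h₁, h₂, hM⟩
    refine (EqComp.node f g (ih h₁) (ih h₂)).congr fun x y => ?_
    rw [hM]
    by_cases h : f x = g y <;> simp [h]

theorem EqComp.flip {d : ℕ} :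
    ∀ {M : X → Y → Prop}, EqComp d M → EqComp (d + 1) (fun y x => M x y) := by
  induction d with
  | zero =>
    rintro M ⟨φ, hφ⟩
    refine (EqComp.node (fun _ => True) φ (EqComp.const True) (EqComp.const False)).congr
      fun y x => ?_
    simp [hφ]
  | succ d ih =>
    rintro M ⟨T, f, g, M₁, M₂, h₁, h₂, hM⟩
    refine (EqComp.node g f (ih h₁) (ih h₂)).congr fun y x => ?_
    rw [hM]
    simp only [ne_eq, eq_comm]

/-- Once an equality `f x = g y = t` has been established, the two parties can continue with a
protocol that depends on `t`. -/
theorem EqComp.glue {T : Type} {d : ℕ} : ∀ {M : T → X → Y → Prop}, (∀ t, EqComp d (M t)) →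
    ∀ (f : X → T) (g : Y → T),
      ∃ N : X → Y → Prop, EqComp d N ∧ ∀ x y, f x = g y → (N x y ↔ M (g y) x y) := by
  induction d with
  | zero =>
    intro M hM f g
    choose φ hφ using hM
    refine ⟨fun x _ => φ (f x) x, ⟨fun x => φ (f x) x, fun _ _ => Iff.rfl⟩, fun x y h => ?_⟩
    simp only [hφ, h]
  | succ d ih =>
    intro M hM f g
    choose T' f' g' M₁ M₂ h₁ h₂ hM' using hM
    obtain ⟨N₁, hN₁, e₁⟩ := ih h₁ f g
    obtain ⟨N₂, hN₂, e₂⟩ := ih h₂ f g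
    refine ⟨_, EqComp.node (T := Σ t, T' t) (fun x => ⟨f x, f' (f x) x⟩)
      (fun y => ⟨g y, g' (g y) y⟩) hN₁ hN₂, fun x y h => ?_⟩
    have hs : (⟨f x, f' (f x) x⟩ : Σ t, T' t) = ⟨g y, g' (g y) y⟩ ↔
        f' (g y) x = g' (g y) y := by
      rw [h]
      simp
    simp only [hM', e₁ x y h, e₂ x y h, hs, ne_eq]

/-- If `x` knows at most `K` labels that the label `g y` has to match for a protocol from a
given family to be usable, then `K` further queries suffice to find the match. The predicate `N₀`
is used when there is none. -/
theorem EqComp.glue_finset {T : Type} {d : ℕ} {M N₀ : X → Y → Prop} (hN₀ : EqComp d N₀)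
    (B : Set Y) (g : Y → T) (K : ℕ) : ∀ (F : X → Finset T), (∀ x, (F x).card ≤ K) →
    (∀ t, EqCompOn d {x | t ∈ F x} {y | y ∈ B ∧ g y = t} M) →
      ∃ N : X → Y → Prop, EqComp (d + K) N ∧
        ∀ x, ∀ y ∈ B, (g y ∈ F x → (N x y ↔ M x y)) ∧ (g y ∉ F x → (N x y ↔ N₀ x y)) := by
  classical
  induction K with
  | zero =>
    intro F hF _
    refine ⟨N₀, hN₀, fun x y _ => ⟨fun h => ?_, fun _ => Iff.rfl⟩⟩
    have := Finset.card_eq_zero.1 (Nat.le_zero.1 (hF x))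
    simp [this] at h
  | succ K ih =>
    intro F hF hM
    let f : X → Option T := fun x => if h : (F x).Nonempty then some h.choose else none
    have hf : ∀ x t, f x = some t → t ∈ F x := by
      intro x t h
      by_cases hx : (F x).Nonempty
      · simp only [f, dif_pos hx, Option.some.injEq] at h
        exact h ▸ hx.choose_spec
      · simp [f, dif_neg hx] at h
    let F' : X → Finset T := fun x => (F x).filter fun t => f x ≠ some t
    have hF' : ∀ x, (F' x).card ≤ K := by
      intro x
      by_cases hx : (F x).Nonempty
      · have : F' x ⊆ (F x).erase hx.choose := by
          intro t ht
          simp only [F', Finset.mem_filter, f, dif_pos hx, ne_eq, Option.some.injEq] at ht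
          exact Finset.mem_erase.2 ⟨fun e => ht.2 e.symm, ht.1⟩
        have h1 := Finset.card_le_card this
        rw [Finset.card_erase_of_mem hx.choose_spec] at h1
        have := hF x
        omega
      · rw [Finset.not_nonempty_iff_eq_empty] at hx
        simp [F', hx]
    obtain ⟨N', hN', hN'M⟩ := ih F' hF' fun t => by
      obtain ⟨N, hN, h⟩ := hM t
      exact ⟨N, hN, fun x hx y hy => h x (Finset.mem_of_mem_filter t hx) y hy⟩
    choose Nt hNt hNtM using hM
    obtain ⟨N'', hN'', hN''M⟩ := EqComp.glue (M := fun t : Option T => t.elim N₀ Nt)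
      (fun t => by cases t with
        | none => exact hN₀
        | some t => exact hNt t) f (fun y => some (g y))
    refine ⟨_, EqComp.node f (fun y => some (g y)) (hN''.mono (Nat.le_add_right d K)) hN', ?_⟩
    intro x y hy
    by_cases h : f x = some (g y)
    · have h1 : N'' x y ↔ M x y := by
        rw [hN''M x y h]
        exact hNtM (g y) x (hf x _ h) y ⟨hy, rfl⟩
      simp [h, h1, hf x _ h]
    · have h1 : g y ∈ F' x ↔ g y ∈ F x := by simp [F', h]
      simpa [h, h1] using hN'M x y hy

/-- The counterpart of `EqComp.glue_finset` in which the labels are known to `y`. -/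
theorem EqComp.glue_finset_right {T : Type} {d : ℕ} {M N₀ : X → Y → Prop} (hN₀ : EqComp d N₀)
    (A : Set X) (g : X → T) (K : ℕ) (F : Y → Finset T) (hF : ∀ y, (F y).card ≤ K)
    (hM : ∀ t, EqCompOn d {x | x ∈ A ∧ g x = t} {y | t ∈ F y} M) :
    ∃ N : X → Y → Prop, EqComp (d + K + 2) N ∧
      ∀ x ∈ A, ∀ y, (g x ∈ F y → (N x y ↔ M x y)) ∧ (g x ∉ F y → (N x y ↔ N₀ x y)) := by
  obtain ⟨N, hN, h⟩ := EqComp.glue_finset (M := fun y x => M x y) hN₀.flip A g K F hF fun t => by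
    obtain ⟨N, hN, h⟩ := hM t
    exact ⟨_, hN.flip, fun y hy x hx => h x hx y hy⟩
  exact ⟨_, hN.flip.mono (by omega), fun x hx y => h y x hx⟩

theorem EqCompOn.split_left {d : ℕ} {A : Set X} {B : Set Y} {M : X → Y → Prop} (φ : X → Prop)
    (h₁ : EqCompOn d {x | x ∈ A ∧ φ x} B M) (h₂ : EqCompOn d {x | x ∈ A ∧ ¬ φ x} B M) :
    EqCompOn (d + 1) A B M := by
  obtain ⟨N₁, hN₁, e₁⟩ := h₁
  obtain ⟨N₂, hN₂, e₂⟩ := h₂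
  refine ⟨_, EqComp.node φ (fun _ => True) hN₁ hN₂, fun x hx y hy => ?_⟩
  by_cases h : φ x
  · simp [h, e₁ x ⟨hx, h⟩ y hy]
  · simp [h, e₂ x ⟨hx, h⟩ y hy]

theorem EqCompOn.split_right {d : ℕ} {A : Set X} {B : Set Y} {M : X → Y → Prop} (φ : Y → Prop)
    (h₁ : EqCompOn d A {y | y ∈ B ∧ φ y} M) (h₂ : EqCompOn d A {y | y ∈ B ∧ ¬ φ y} M) :
    EqCompOn (d + 1) A B M := by
  obtain ⟨N₁, hN₁, e₁⟩ := h₁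
  obtain ⟨N₂, hN₂, e₂⟩ := h₂
  refine ⟨_, EqComp.node (fun _ => True) φ hN₁ hN₂, fun x hx y hy => ?_⟩
  by_cases h : φ y
  · simp [h, e₁ x hx y ⟨hy, h⟩]
  · simp [h, e₂ x hx y ⟨hy, h⟩]

end EqComp

end SignRankGraphs

/-! ### Gyárfás decompositions -/

namespace SignRankGraphs

/-- The restriction of a relation to a set. -/
def RelOn {V : Type} (E : V → V → Prop) (C : Set V) (a b : V) : Prop := E a b ∧ a ∈ C ∧ b ∈ C

/-- The connected component of `u` in the subgraph induced by `C`. -/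
def compOf {V : Type} (E : V → V → Prop) (C : Set V) (u : V) : Set V :=
  {w | Relation.ReflTransGen (RelOn E C) u w}

/-- A Gyárfás decomposition of the subgraph induced by `C`: a rooted spanning forest, given by the
list `L u` of the proper ancestors of each vertex `u`, the parent first and the root last. Every
path to a root is induced. The vertices with the same list of ancestors form a bag, and two
adjacent vertices lie in bags one of which is an ancestor of the other. -/
structure IsGyarfas {V : Type} (E : V → V → Prop) (C : Set V) (L : V → List V) : Prop where
  step : ∀ u ∈ C, L u = [] ∨
    ∃ x t, L u = x :: t ∧ x ∈ C ∧ L x = t ∧ E u x ∧ ∀ v ∈ t, ¬ E u v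
  edge : ∀ u ∈ C, ∀ w ∈ C, E u w → L u <:+ L w ∨ L w <:+ L u
  root : ∀ u ∈ C, L u = [] → ∀ w ∈ C, E u w → L w = [u]

section Components

variable {V : Type} {E : V → V → Prop}

theorem RelOn.symm (hE : ∀ a b, E a b → E b a) (C : Set V) (a b : V) (h : RelOn E C a b) :
    RelOn E C b a :=
  ⟨hE _ _ h.1, h.2.2, h.2.1⟩

theorem reflTransGen_relOn_symm (hE : ∀ a b, E a b → E b a) {C : Set V} {u w : V}
    (h : Relation.ReflTransGen (RelOn E C) u w) : Relation.ReflTransGen (RelOn E C) w u :=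
  have : Std.Symm (RelOn E C) := ⟨RelOn.symm hE C⟩
  Relation.ReflTransGen.stdSymm.symm _ _ h

theorem compOf_subset {C : Set V} {u : V} (hu : u ∈ C) : compOf E C u ⊆ C := by
  intro w hw
  induction hw with
  | refl => exact hu
  | tail _ h _ => exact h.2.2

theorem mem_compOf_self (C : Set V) (u : V) : u ∈ compOf E C u := Relation.ReflTransGen.refl

theorem compOf_eq (hE : ∀ a b, E a b → E b a) {C : Set V} {u w : V} (h : w ∈ compOf E C u) :
    compOf E C w = compOf E C u := by
  have hs : w ∈ compOf E C u → u ∈ compOf E C w := fun h =>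
    reflTransGen_relOn_symm hE h
  ext v
  exact ⟨fun hv => Relation.ReflTransGen.trans h hv,
    fun hv => Relation.ReflTransGen.trans (hs h) hv⟩

theorem compOf_eq_of_adj (hE : ∀ a b, E a b → E b a) {C : Set V} {u w : V} (hu : u ∈ C)
    (hw : w ∈ C) (h : E u w) : compOf E C w = compOf E C u :=
  compOf_eq hE (Relation.ReflTransGen.single ⟨h, hu, hw⟩)

theorem reflTransGen_compOf {C : Set V} {u w : V} (hw : w ∈ compOf E C u) :
    Relation.ReflTransGen (RelOn E (compOf E C u)) u w := by
  induction hw with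
  | refl => exact Relation.ReflTransGen.refl
  | tail hab h ih => exact ih.tail ⟨h.1, hab, hab.tail h⟩

theorem reflTransGen_relOn_mono {C D : Set V} (hCD : C ⊆ D) {u w : V}
    (h : Relation.ReflTransGen (RelOn E C) u w) : Relation.ReflTransGen (RelOn E D) u w :=
  Relation.ReflTransGen.mono (show RelOn E C ≤ RelOn E D from
    fun _ _ h => ⟨h.1, hCD h.2.1, hCD h.2.2⟩) _ _ h

/-- A connected set has a Gyárfás decomposition with a prescribed root `r`: the neighbours of `r`
form the top bag, and each component of the rest is attached to a neighbour of `r` which is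
adjacent to it (its hook). -/
theorem exists_isGyarfas_of_connected (hE : ∀ a b, E a b → E b a) (hirr : ∀ a, ¬ E a a) (n : ℕ) :
    ∀ (C : Set V) (r : V), C.Finite → C.ncard ≤ n → r ∈ C →
      (∀ u ∈ C, Relation.ReflTransGen (RelOn E C) r u) →
      ∃ L : V → List V, IsGyarfas E C L ∧ ∀ u ∈ C, (L u = [] ↔ u = r) := by
  classical
  induction n with
  | zero =>
    intro C r hfin hcard hr _
    have := (Set.ncard_eq_zero hfin).1 (Nat.le_zero.1 hcard)
    simp [this] at hr
  | succ n ih =>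
    intro C r hfin hcard hr hconn
    set D : Set V := {u | u ∈ C ∧ u ≠ r ∧ ¬ E r u}
    have hDC : D ⊆ C := fun u hu => hu.1
    -- every component of `D` has a hook
    have hook : ∀ u, Relation.ReflTransGen (RelOn E C) r u → u ∈ D →
        ∃ h ∈ C, E r h ∧ ∃ w ∈ compOf E D u, E h w := by
      intro u hu
      induction hu with
      | refl => exact fun h => absurd rfl h.2.1
      | @tail a b hab h ih' =>
        intro hb
        by_cases ha : a ∈ D
        · rw [compOf_eq_of_adj hE ha hb h.1]
          exact ih' ha
        · have har : a ≠ r := fun e => hb.2.2 (e ▸ h.1)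
          have hra : E r a := by
            by_contra hra
            exact ha ⟨h.2.1, har, hra⟩
          exact ⟨a, h.2.1, hra, b, mem_compOf_self D b, h.1⟩
    have key : ∀ K : Set V, (∃ u ∈ D, K = compOf E D u) →
        ∃ (h : V) (L : V → List V), h ∈ C ∧ E r h ∧ IsGyarfas E (insert h K) L ∧
          ∀ u ∈ insert h K, (L u = [] ↔ u = h) := by
      rintro K ⟨u, hu, rfl⟩
      obtain ⟨h, hhC, hrh, w, hw, hhw⟩ := hook u (hconn u (hDC hu)) hu
      have hKD := compOf_subset (E := E) hu
      have hsub : insert h (compOf E D u) ⊆ C \ {r} := by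
        rintro v (rfl | hv)
        · exact ⟨hhC, fun e => hirr r (by rw [Set.mem_singleton_iff] at e; rwa [e] at hrh)⟩
        · exact ⟨hDC (hKD hv), (hKD hv).2.1⟩
      obtain ⟨L, hL⟩ := ih (insert h (compOf E D u)) h (hfin.subset (hsub.trans Set.sdiff_subset))
        (by
          have h1 := Set.ncard_le_ncard hsub (hfin.subset Set.sdiff_subset)
          have h2 := Set.ncard_sdiff_singleton_lt_of_mem hr hfin
          omega) (Set.mem_insert _ _) (by
          rintro v (rfl | hv)
          · exact Relation.ReflTransGen.refl
          · have hm := Set.subset_insert h (compOf E D u)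
            have h1 := reflTransGen_relOn_mono hm (reflTransGen_compOf hw)
            have h2 := reflTransGen_relOn_mono hm (reflTransGen_compOf hv)
            exact ((reflTransGen_relOn_symm hE h1).trans h2).head
              ⟨hhw, Set.mem_insert _ _, hm hw⟩)
      exact ⟨h, L, hhC, hrh, hL⟩
    have : Nonempty V := ⟨r⟩
    choose! hk LK hkC hkr hLK hLKroot using key
    let L : V → List V := fun u =>
      if u = r then [] else if E r u then [r] else LK (compOf E D u) u ++ [r]
    have Lr : L r = [] := by simp [L]
    have LN : ∀ u, E r u → L u = [r] := fun u hu => by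
      have : u ≠ r := fun e => hirr r (by rwa [e] at hu)
      simp [L, this, hu]
    have LD : ∀ u ∈ D, L u = LK (compOf E D u) u ++ [r] := fun u hu => by
      simp [L, hu.2.1, hu.2.2]
    have cases : ∀ u ∈ C, u = r ∨ E r u ∨ u ∈ D := fun u hu => by
      by_cases h1 : u = r
      · exact Or.inl h1
      · by_cases h2 : E r u
        · exact Or.inr (Or.inl h2)
        · exact Or.inr (Or.inr ⟨hu, h1, h2⟩)
    have Lroot : ∀ u ∈ C, (L u = [] ↔ u = r) := by
      intro u hu
      rcases cases u hu with rfl | h | h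
      · simp [Lr]
      · have : u ≠ r := fun e => hirr r (by rwa [e] at h)
        simp [LN u h, this]
      · simp [LD u h, h.2.1]
    refine ⟨L, ⟨?_, ?_, ?_⟩, Lroot⟩
    · intro u hu
      rcases cases u hu with rfl | h | h
      · exact Or.inl Lr
      · exact Or.inr ⟨r, [], LN u h, hr, Lr, hE _ _ h, by simp⟩
      · right
        have hK : ∃ v ∈ D, compOf E D u = compOf E D v := ⟨u, h, rfl⟩
        have hu' : u ∈ insert (hk (compOf E D u)) (compOf E D u) :=
          Or.inr (mem_compOf_self D u)
        have hne : u ≠ hk (compOf E D u) := fun e => h.2.2 (e ▸ hkr _ hK)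
        rcases (hLK _ hK).step u hu' with h0 | ⟨x, t, hx, hxK, hLx, hux, hut⟩
        · exact absurd ((hLKroot _ hK u hu').1 h0) hne
        · refine ⟨x, t ++ [r], by rw [LD u h, hx]; rfl, ?_, ?_, hux, ?_⟩
          · rcases hxK with rfl | hxK
            · exact hkC _ hK
            · exact hDC (compOf_subset h hxK)
          · rcases hxK with e | hxK
            · have h0 : LK (compOf E D u) x = [] :=
                (hLKroot _ hK x (Or.inl e)).2 e
              rw [LN x (e ▸ hkr _ hK), ← hLx, h0]
              rfl
            · rw [LD x (compOf_subset h hxK), compOf_eq hE hxK, hLx]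
          · intro v hv
            rcases List.mem_append.1 hv with hv | hv
            · exact hut v hv
            · rw [List.mem_singleton.1 hv]
              exact fun e => h.2.2 (hE _ _ e)
    · intro u hu w hw huw
      rcases cases u hu with rfl | h | h
      · rw [Lr]
        exact Or.inl (List.nil_suffix)
      · rw [LN u h]
        rcases cases w hw with rfl | h' | h'
        · rw [Lr]
          exact Or.inr (List.nil_suffix)
        · rw [LN w h']
          exact Or.inl (List.suffix_refl _)
        · rw [LD w h']
          exact Or.inl (List.suffix_append _ _)
      · rcases cases w hw with rfl | h' | h'
        · rw [Lr]
          exact Or.inr (List.nil_suffix)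
        · rw [LN w h', LD u h]
          exact Or.inr (List.suffix_append _ _)
        · have hK : ∃ v ∈ D, compOf E D u = compOf E D v := ⟨u, h, rfl⟩
          have hc := compOf_eq_of_adj hE h h' huw
          rw [LD u h, LD w h', hc]
          have hw' : w ∈ compOf E D u := hc ▸ mem_compOf_self D w
          rcases (hLK _ hK).edge u (Or.inr (mem_compOf_self D u)) w (Or.inr hw') huw with
            ⟨s, hs⟩ | ⟨s, hs⟩
          · exact Or.inl ⟨s, by rw [← hs, List.append_assoc]⟩
          · exact Or.inr ⟨s, by rw [← hs, List.append_assoc]⟩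
    · intro u hu h0 w hw huw
      rw [Lroot u hu] at h0
      subst h0
      exact LN w huw

/-- Every finite set has a Gyárfás decomposition in which each component has its root in a given
set `A`, if it meets `A`; a component that avoids `A` is an isolated vertex if all edges meet
`A`. -/
theorem exists_isGyarfas [Finite V] (hE : ∀ a b, E a b → E b a) (hirr : ∀ a, ¬ E a a)
    (C A : Set V) (hA : ∀ a b, E a b → a ∈ A ∨ b ∈ A) :
    ∃ L : V → List V, IsGyarfas E C L ∧
      ∀ u ∈ C, L u = [] → u ∈ A ∨ ∀ w ∈ C, ¬ E u w := by
  have key : ∀ K : Set V, (∃ u ∈ C, K = compOf E C u) → ∃ (r : V) (L : V → List V),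
      ((∃ a ∈ K, a ∈ A) → r ∈ A) ∧ IsGyarfas E K L ∧ ∀ u ∈ K, (L u = [] ↔ u = r) := by
    rintro K ⟨u, hu, rfl⟩
    obtain ⟨r, hrK, hr⟩ : ∃ r ∈ compOf E C u, (∃ a ∈ compOf E C u, a ∈ A) → r ∈ A := by
      by_cases h : ∃ a ∈ compOf E C u, a ∈ A
      · obtain ⟨a, ha, haA⟩ := h
        exact ⟨a, ha, fun _ => haA⟩
      · exact ⟨u, mem_compOf_self C u, fun h' => absurd h' h⟩
    obtain ⟨L, hL⟩ := exists_isGyarfas_of_connected hE hirr _ (compOf E C u) r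
      (Set.toFinite _) le_rfl hrK (by
        intro v hv
        exact (reflTransGen_relOn_symm hE (reflTransGen_compOf hrK)).trans (reflTransGen_compOf hv))
    exact ⟨r, L, hr, hL⟩
  rcases isEmpty_or_nonempty V with hV | hV
  · exact ⟨fun _ => [], ⟨fun u => isEmptyElim u, fun u => isEmptyElim u, fun u => isEmptyElim u⟩,
      fun u => isEmptyElim u⟩
  choose! r LK hr hLK hroot using key
  have hK : ∀ u ∈ C, ∃ v ∈ C, compOf E C u = compOf E C v := fun u hu => ⟨u, hu, rfl⟩
  have hself := mem_compOf_self (E := E) C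
  refine ⟨fun u => LK (compOf E C u) u, ⟨?_, ?_, ?_⟩, ?_⟩
  · intro u hu
    rcases (hLK _ (hK u hu)).step u (hself u) with h | ⟨x, t, h1, h2, h3, h4⟩
    · exact Or.inl h
    · exact Or.inr ⟨x, t, h1, compOf_subset hu h2, by rw [compOf_eq hE h2, h3], h4⟩
  · intro u hu w hw huw
    have hc := compOf_eq_of_adj hE hu hw huw
    simp only [hc]
    exact (hLK _ (hK u hu)).edge u (hself u) w (hc ▸ hself w) huw
  · intro u hu h0 w hw huw
    have hc := compOf_eq_of_adj hE hu hw huw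
    simp only [hc]
    exact (hLK _ (hK u hu)).root u (hself u) h0 w (hc ▸ hself w) huw
  · intro u hu h0
    by_contra! hcon
    obtain ⟨huA, w, hw, huw⟩ := hcon
    have hc := compOf_eq_of_adj hE hu hw huw
    refine huA ?_
    rw [(hroot _ (hK u hu) u (hself u)).1 h0]
    exact hr _ (hK u hu) ⟨w, hc ▸ hself w, (hA u w huw).resolve_left huA⟩

end Components

section IsGyarfas

variable {V : Type} {E : V → V → Prop} {C : Set V} {L : V → List V}

theorem IsGyarfas.of_eq_cons (hL : IsGyarfas E C L) {u x : V} {t : List V} (hu : u ∈ C)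
    (h : L u = x :: t) : x ∈ C ∧ L x = t ∧ E u x ∧ ∀ v ∈ t, ¬ E u v := by
  rcases hL.step u hu with h0 | ⟨x', t', h1, h2⟩
  · simp [h0] at h
  · rw [h1, List.cons.injEq] at h
    obtain ⟨rfl, rfl⟩ := h
    exact h2

theorem IsGyarfas.of_suffix (hL : IsGyarfas E C L) {x : V} {t : List V} (s : List V) :
    ∀ u ∈ C, L u = s ++ x :: t → x ∈ C ∧ L x = t := by
  induction s with
  | nil =>
    intro u hu h
    have := hL.of_eq_cons hu h
    exact ⟨this.1, this.2.1⟩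
  | cons y s ih =>
    intro u hu h
    have := hL.of_eq_cons hu h
    exact ih y this.1 this.2.1

/-- A vertex is not adjacent to its proper ancestors other than its parent. -/
theorem IsGyarfas.not_adj (hL : IsGyarfas E C L) {u x : V} {t : List V} (hu : u ∈ C)
    (h : (x :: t) <:+ L u) (hlen : t.length + 1 < (L u).length) : ¬ E u x := by
  obtain ⟨s, hs⟩ := h
  cases s with
  | nil =>
    rw [← hs] at hlen
    simp at hlen
  | cons y s =>
    exact (hL.of_eq_cons hu hs.symm).2.2.2 x (by simp)

end IsGyarfas

end SignRankGraphs

/-! ### Back-degrees in order-preserving bipartite graphs -/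

namespace SignRankGraphs

/-- Rows and columns are placed on a line by `p` and `q`, and whenever the rows `x, x'` and the
columns `y, y'` span an induced matching `xy, x'y'`, the two edges are in the same order on both
sides. -/
def OrderPreserving {X Y : Type} (M : X → Y → Prop) (p : X → ℝ) (q : Y → ℝ) : Prop :=
  ∀ x y x' y', M x y → M x' y' → ¬ M x y' → ¬ M x' y →
    (p x < p x' ∧ q y < q y') ∨ (p x' < p x ∧ q y' < q y)

/-- There is a chain `a 1, …, a k`, `b 1, …, b k` of length `k` with rows in `A` and columns
in `B`. -/
def HasChainOn {X Y : Type} (M : X → Y → Prop) (A : Set X) (B : Set Y) (k : ℕ) : Prop :=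
  ∃ (a : Fin k → X) (b : Fin k → Y), (∀ i, a i ∈ A) ∧ (∀ i, b i ∈ B) ∧
    ∀ i j, i < j → M (a i) (b j) ∧ ¬ M (a j) (b i)

/-- The adjacency relation on `X ⊕ Y` of the bipartite graph with edges `M`. -/
def sumAdj {X Y : Type} (M : X → Y → Prop) : X ⊕ Y → X ⊕ Y → Prop
  | .inl x, .inr y => M x y
  | .inr y, .inl x => M x y
  | _, _ => False

section OrderPreserving

variable {X Y : Type} {M : X → Y → Prop} {p : X → ℝ} {q : Y → ℝ} {A : Set X} {B : Set Y} {k : ℕ}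

theorem OrderPreserving.not (h : OrderPreserving M p q) :
    OrderPreserving (fun x y => ¬ M x y) p (fun y => - q y) := by
  intro x y x' y' h1 h2 h3 h4
  simp only [neg_lt_neg_iff]
  exact h x y' x' y (not_not.1 h3) (not_not.1 h4) h1 h2

theorem HasChainOn.not (h : HasChainOn M A B k) : HasChainOn (fun x y => ¬ M x y) A B k := by
  obtain ⟨a, b, ha, hb, h⟩ := h
  refine ⟨fun i => a i.rev, fun i => b i.rev, fun i => ha _, fun i => hb _, fun i j hij => ?_⟩
  have := h _ _ (Fin.rev_lt_rev.2 hij)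
  exact ⟨this.2, not_not.2 this.1⟩

theorem HasChainOn.mono {A' : Set X} {B' : Set Y} (h : HasChainOn M A B k) (hA : A ⊆ A')
    (hB : B ⊆ B') : HasChainOn M A' B' k := by
  obtain ⟨a, b, ha, hb, h⟩ := h
  exact ⟨a, b, fun i => hA (ha i), fun i => hB (hb i), h⟩

theorem HasChainOn.cons {x : X} {y : Y} (h : HasChainOn M A B k) (hx : ∀ b ∈ B, M x b)
    (hy : ∀ a ∈ A, ¬ M a y) : HasChainOn M (insert x A) (insert y B) (k + 1) := by
  obtain ⟨a, b, ha, hb, h⟩ := h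
  refine ⟨Fin.cons x a, Fin.cons y b, fun i => ?_, fun i => ?_, fun i j hij => ?_⟩
  · refine Fin.cases ?_ (fun i => ?_) i
    · exact Set.mem_insert _ _
    · exact Or.inr (ha i)
  · refine Fin.cases ?_ (fun i => ?_) i
    · exact Set.mem_insert _ _
    · exact Or.inr (hb i)
  · obtain ⟨j, rfl⟩ := Fin.exists_succ_eq.2 (Fin.ne_zero_of_lt hij)
    revert hij
    refine Fin.cases (fun _ => ?_) (fun i hij => ?_) i
    · exact ⟨hx _ (hb j), hy _ (ha j)⟩
    · exact h i j (Fin.succ_lt_succ_iff.1 hij)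

theorem HasChainOn.snoc {x : X} {y : Y} (h : HasChainOn M A B k) (hx : ∀ b ∈ B, ¬ M x b)
    (hy : ∀ a ∈ A, M a y) : HasChainOn M (insert x A) (insert y B) (k + 1) := by
  have := (h.not.cons (x := x) (y := y) hx (fun a ha => not_not.2 (hy a ha))).not
  simpa only [not_not] using this

theorem sumAdj_symm (M : X → Y → Prop) (a b : X ⊕ Y) (h : sumAdj M a b) : sumAdj M b a := by
  cases a <;> cases b <;> exact h

theorem sumAdj_side (a b : X ⊕ Y) (h : sumAdj M a b) : b.isLeft = !a.isLeft := by
  cases a <;> cases b <;> first | rfl | exact h.elim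

theorem sumAdj_irrefl (M : X → Y → Prop) (a : X ⊕ Y) : ¬ sumAdj M a a := by
  cases a <;> exact fun h => h

/-- The order condition in a form that treats the two sides alike. -/
theorem OrderPreserving.sumAdj (h : OrderPreserving M p q) {u v u' v' : X ⊕ Y}
    (hs : u.isLeft = u'.isLeft) (h₁ : sumAdj M u v) (h₂ : sumAdj M u' v') (h₃ : ¬ sumAdj M u v')
    (h₄ : ¬ sumAdj M u' v) :
    (Sum.elim p q u < Sum.elim p q u' ∧ Sum.elim p q v < Sum.elim p q v') ∨
      (Sum.elim p q u' < Sum.elim p q u ∧ Sum.elim p q v' < Sum.elim p q v) := by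
  rcases u with x | y <;> rcases u' with x' | y'
  · rcases v with _ | y
    · exact h₁.elim
    rcases v' with _ | y'
    · exact h₂.elim
    exact h x y x' y' h₁ h₂ h₃ h₄
  · simp at hs
  · simp at hs
  · rcases v with x | _
    · rcases v' with x' | _
      · have := h x y x' y' h₁ h₂ h₄ h₃
        exact this.imp And.symm And.symm
      · exact h₂.elim
    · exact h₁.elim

/-- The edges `p i q i` form an induced matching (they are distant edges of an induced path in the
application), and `w i` is adjacent to `p i` and to none of the earlier `p j`. If a single vertex
`u` is adjacent to all the `w i` and to none of the `q i`, then for half of the indices the `p`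
and the `w` form a half-graph. Indeed, the order condition, applied to the matchings of `u w i` and
of `p i w i` with `p j q j`, shows that `u` and `p i` are on the same side of `p j` for `j < i`,
and also for `j > i` if `w i` and `p j` are not adjacent; the latter is impossible when
`p i` and `p j` are on the same side of `u`. -/
theorem exists_halfGraph {V : Type} {E : V → V → Prop} {side : V → Bool} {pos : V → ℝ}
    (hside : ∀ a b, E a b → side b = !side a)
    (hpos : ∀ a b a' b', side a = side a' → E a b → E a' b' → ¬ E a b' → ¬ E a' b →
      (pos a < pos a' ∧ pos b < pos b') ∨ (pos a' < pos a ∧ pos b' < pos b))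
    (I : Finset ℕ) (p q w : ℕ → V) (u : V)
    (hpq : ∀ i ∈ I, E (p i) (q i)) (hpw : ∀ i ∈ I, E (p i) (w i)) (huw : ∀ i ∈ I, E u (w i))
    (huq : ∀ i ∈ I, ¬ E u (q i))
    (hpq' : ∀ i ∈ I, ∀ j ∈ I, i < j → ¬ E (p i) (q j) ∧ ¬ E (p j) (q i) ∧ ¬ E (p i) (w j)) :
    ∃ J ⊆ I, I.card ≤ 2 * J.card ∧ ∀ i ∈ J, ∀ j ∈ J, i < j → E (p j) (w i) := by
  have hsu : ∀ i ∈ I, side (p i) = side u := by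
    intro i hi
    have h1 := hside _ _ (hpw i hi)
    have h2 := hside _ _ (huw i hi)
    rw [h1] at h2
    simpa using h2
  have before : ∀ l ∈ I, ∀ i ∈ I, l < i →
      (pos (p l) < pos u ↔ pos (p l) < pos (p i)) ∧ (pos u < pos (p l) ↔ pos (p i) < pos (p l)) := by
    intro l hl i hi hli
    obtain ⟨h1, h2, h3⟩ := hpq' l hl i hi hli
    have e1 := hpos u (w i) (p l) (q l) (hsu l hl).symm (huw i hi) (hpq l hl) (huq l hl) h3
    have e2 := hpos (p i) (w i) (p l) (q l) ((hsu i hi).trans (hsu l hl).symm) (hpw i hi)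
      (hpq l hl) h2 h3
    constructor <;> constructor <;> intro h <;> grind
  have after : ∀ i ∈ I, ∀ j ∈ I, i < j → ¬ E (p j) (w i) →
      (pos (p j) < pos u ↔ pos (p j) < pos (p i)) ∧ (pos u < pos (p j) ↔ pos (p i) < pos (p j)) := by
    intro i hi j hj hij hn
    obtain ⟨h1, h2, h3⟩ := hpq' i hi j hj hij
    have e1 := hpos u (w i) (p j) (q j) (hsu j hj).symm (huw i hi) (hpq j hj) (huq j hj) hn
    have e2 := hpos (p i) (w i) (p j) (q j) ((hsu i hi).trans (hsu j hj).symm) (hpw i hi)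
      (hpq j hj) h1 hn
    constructor <;> constructor <;> intro h <;> grind
  have ne : ∀ i ∈ I, ∀ j ∈ I, i < j → pos (p i) ≠ pos u := by
    intro i hi j hj hij
    obtain ⟨h1, h2, h3⟩ := hpq' i hi j hj hij
    have e1 := hpos u (w j) (p i) (q i) (hsu i hi).symm (huw j hj) (hpq i hi) (huq i hi) h3
    grind
  have hcard := Finset.card_filter_add_card_filter_not (s := I) (fun i => pos (p i) < pos u)
  by_cases hc : I.card ≤ 2 * (I.filter fun i => pos (p i) < pos u).card
  · refine ⟨_, Finset.filter_subset _ _, hc, fun i hi j hj hij => ?_⟩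
    rw [Finset.mem_filter] at hi hj
    by_contra hn
    have h1 := before i hi.1 j hj.1 hij
    have h2 := after i hi.1 j hj.1 hij hn
    grind
  · refine ⟨I.filter fun i => ¬ pos (p i) < pos u, Finset.filter_subset _ _, by omega,
      fun i hi j hj hij => ?_⟩
    rw [Finset.mem_filter] at hi hj
    by_contra hn
    have h1 := before i hi.1 j hj.1 hij
    have h2 := after i hi.1 j hj.1 hij hn
    have h3 := ne i hi.1 j hj.1 hij
    grind

/-- In a Gyárfás decomposition of an order-preserving bipartite graph without chains of length `k`
every vertex has neighbours in boundedly many bags above its own. -/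
theorem IsGyarfas.card_le {L : X ⊕ Y → List (X ⊕ Y)} (hM : OrderPreserving M p q)
    (hL : IsGyarfas (sumAdj M) {v | Sum.elim (· ∈ A) (· ∈ B) v} L) (hk : ¬ HasChainOn M A B k)
    (u : X ⊕ Y) (hu : Sum.elim (· ∈ A) (· ∈ B) u) (F : Finset (List (X ⊕ Y)))
    (hF : ∀ l ∈ F, l ≠ [] ∧ l <:+ L u ∧
      ∃ w, Sum.elim (· ∈ A) (· ∈ B) w ∧ sumAdj M u w ∧ L w = l) :
    F.card ≤ 8 * k + 2 := by
  classical
  by_contra! hcard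
  have hlen : ∀ l ∈ F, ∀ l' ∈ F, l.length ≤ l'.length → l <:+ l' := fun l hl l' hl' h =>
    List.suffix_of_suffix_length_le (hF l hl).2.1 (hF l' hl').2.1 h
  let I₀ : Finset ℕ := (F.image List.length).filter fun n => n + 2 ≤ (L u).length
  have hI₀ : 8 * k < I₀.card := by
    have h1 : (F.image List.length).card = F.card := Finset.card_image_of_injOn fun l hl l' hl' h =>
      (hlen l hl l' hl' h.le).eq_of_length h
    have h2 : F.image List.length ⊆ I₀ ∪ {(L u).length, (L u).length - 1} := by
      intro n hn
      obtain ⟨l, hl, rfl⟩ := Finset.mem_image.1 hn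
      have := (hF l hl).2.1.length_le
      by_cases h : l.length + 2 ≤ (L u).length
      · exact Finset.mem_union_left _ (Finset.mem_filter.2 ⟨hn, h⟩)
      · refine Finset.mem_union_right _ ?_
        simp only [Finset.mem_insert, Finset.mem_singleton]
        omega
    have h3 := (Finset.card_le_card h2).trans (Finset.card_union_le _ _)
    have h4 : ({(L u).length, (L u).length - 1} : Finset ℕ).card ≤ 2 := Finset.card_le_two
    omega
  -- lengths in one residue class modulo four make the chosen edges of the path pairwise distant
  obtain ⟨c, -, hc⟩ := Finset.exists_lt_card_fiber_of_mul_lt_card_of_maps_to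
    (s := I₀) (t := Finset.range 4) (n := 2 * k) (f := fun n => n % 4)
    (fun n _ => Finset.mem_range.2 (Nat.mod_lt _ (by norm_num)))
    (by rw [Finset.card_range]; omega)
  set I := I₀.filter fun n => n % 4 = c
  have hdata : ∀ n ∈ I, ∃ (x y w : X ⊕ Y) (t : List (X ⊕ Y)), (x :: t).length = n ∧
      (y :: x :: t) <:+ L u ∧ Sum.elim (· ∈ A) (· ∈ B) w ∧ sumAdj M u w ∧ L w = x :: t := by
    intro n hn
    have hn0 := Finset.mem_filter.1 (Finset.mem_filter.1 hn).1
    obtain ⟨l, hl, rfl⟩ := Finset.mem_image.1 hn0.1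
    obtain ⟨h1, ⟨s, hs⟩, w, hw, huw, hLw⟩ := hF l hl
    obtain ⟨x, t, rfl⟩ := List.exists_cons_of_ne_nil h1
    rcases List.eq_nil_or_concat' s with rfl | ⟨s', y, rfl⟩
    · have := hn0.2
      rw [← hs] at this
      simp at this
    · exact ⟨x, y, w, t, rfl, ⟨s', by simpa using hs⟩, hw, huw, hLw⟩
  have hV : Nonempty (X ⊕ Y) := ⟨u⟩
  choose! x y w t hlt hyL hw huw hLw using hdata
  have hxL : ∀ n ∈ I, (x n :: t n) <:+ L u := fun n hn => (List.suffix_cons _ _).trans (hyL n hn)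
  have hy : ∀ n ∈ I, Sum.elim (· ∈ A) (· ∈ B) (y n) ∧ L (y n) = x n :: t n := fun n hn => by
    obtain ⟨s, hs⟩ := hyL n hn
    exact hL.of_suffix s u hu hs.symm
  have hx : ∀ n ∈ I, Sum.elim (· ∈ A) (· ∈ B) (x n) ∧ L (x n) = t n := fun n hn => by
    obtain ⟨s, hs⟩ := hxL n hn
    exact hL.of_suffix s u hu hs.symm
  have hxw : ∀ n ∈ I, sumAdj M (x n) (w n) := fun n hn =>
    sumAdj_symm M _ _ (hL.of_eq_cons (hw n hn) (hLw n hn)).2.2.1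
  have hnle : ∀ n ∈ I, n + 2 ≤ (L u).length := fun n hn =>
    (Finset.mem_filter.1 (Finset.mem_filter.1 hn).1).2
  have hgap : ∀ i ∈ I, ∀ j ∈ I, i < j → i + 4 ≤ j := fun i hi j hj hij => by
    have h1 := (Finset.mem_filter.1 hi).2
    have h2 := (Finset.mem_filter.1 hj).2
    omega
  have hlt' : ∀ n ∈ I, (t n).length + 1 = n := fun n hn => by simpa using hlt n hn
  have hyx : ∀ i ∈ I, ∀ j ∈ I, i < j → (y i :: x i :: t i) <:+ t j := fun i hi j hj hij =>
    List.suffix_of_suffix_length_le (hyL i hi) ((List.suffix_cons _ _).trans (hxL j hj)) (by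
      have := hgap i hi j hj hij
      have h1 := hlt' i hi
      have h2 := hlt' j hj
      simp only [List.length_cons]
      omega)
  have hxt : ∀ i ∈ I, ∀ j ∈ I, i < j → (x i :: t i) <:+ t j := fun i hi j hj hij =>
    (List.suffix_cons _ _).trans (hyx i hi j hj hij)
  have hxw' : ∀ i ∈ I, ∀ j ∈ I, i < j → ¬ sumAdj M (x i) (w j) := fun i hi j hj hij h =>
    (hL.of_eq_cons (hw j hj) (hLw j hj)).2.2.2 (x i) ((hxt i hi j hj hij).subset (by simp))
      (sumAdj_symm M _ _ h)
  obtain ⟨J, hJI, hJ, hchain⟩ := exists_halfGraph (E := sumAdj M) (side := Sum.isLeft)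
    (pos := Sum.elim p q) sumAdj_side (fun _ _ _ _ => hM.sumAdj) I x y w u
    (fun n hn => sumAdj_symm M _ _ (hL.of_eq_cons (hy n hn).1 (hy n hn).2).2.2.1)
    hxw huw
    (fun n hn => hL.not_adj hu (hyL n hn) (by
      have := hnle n hn
      have := hlt n hn
      omega))
    (fun i hi j hj hij => ⟨fun h =>
        (hL.of_eq_cons (hy j hj).1 (hy j hj).2).2.2.2 (x i) ((hxt i hi j hj hij).subset (by simp))
          (sumAdj_symm M _ _ h),
      hL.not_adj (hx j hj).1 ((hx j hj).2.symm ▸ hyx i hi j hj hij) (by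
        have := hgap i hi j hj hij
        have h1 := hlt' i hi
        have h2 := hlt' j hj
        rw [(hx j hj).2, List.length_cons]
        omega), hxw' i hi j hj hij⟩)
  have hJk : k ≤ J.card := by omega
  let e : Fin k → ℕ := fun i => J.orderEmbOfFin rfl (Fin.castLE hJk i)
  have heJ : ∀ i, e i ∈ J := fun i => Finset.orderEmbOfFin_mem _ _ _
  have heI : ∀ i, e i ∈ I := fun i => hJI (heJ i)
  have hemono : ∀ i j, i < j → e i < e j := fun i j hij => by
    simpa [e] using hij
  have h1 : ∀ i j, i < j → sumAdj M (x (e j)) (w (e i)) := fun i j hij =>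
    hchain _ (heJ i) _ (heJ j) (hemono i j hij)
  have h2 : ∀ i j, i < j → ¬ sumAdj M (x (e i)) (w (e j)) := fun i j hij =>
    hxw' _ (heI i) _ (heI j) (hemono i j hij)
  have h3 : ∀ i, sumAdj M (x (e i)) (w (e i)) := fun i => hxw _ (heI i)
  have h4 : ∀ i, sumAdj M u (w (e i)) := fun i => huw _ (heI i)
  have h5 : ∀ i, Sum.elim (· ∈ A) (· ∈ B) (x (e i)) := fun i => (hx _ (heI i)).1
  have h6 : ∀ i, Sum.elim (· ∈ A) (· ∈ B) (w (e i)) := fun i => hw _ (heI i)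
  apply hk
  rcases u with u | u
  · have : ∀ i, ∃ a b, x (e i) = Sum.inl a ∧ w (e i) = Sum.inr b := by
      intro i
      have h3 := h3 i
      have h4 := h4 i
      rcases hwe : w (e i) with b | b
      · rw [hwe] at h4
        exact h4.elim
      · rcases hxe : x (e i) with a | a
        · exact ⟨a, b, rfl, rfl⟩
        · rw [hwe, hxe] at h3
          exact h3.elim
    choose a b ha hb using this
    simp only [ha, hb] at h1 h2 h5 h6
    exact ⟨fun i => a i.rev, fun i => b i.rev, fun i => h5 _, fun i => h6 _,
      fun i j hij => ⟨h1 _ _ (Fin.rev_lt_rev.2 hij), h2 _ _ (Fin.rev_lt_rev.2 hij)⟩⟩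
  · have : ∀ i, ∃ a b, w (e i) = Sum.inl a ∧ x (e i) = Sum.inr b := by
      intro i
      have h3 := h3 i
      have h4 := h4 i
      rcases hwe : w (e i) with b | b
      · rcases hxe : x (e i) with a | a
        · rw [hwe, hxe] at h3
          exact h3.elim
        · exact ⟨b, a, rfl, rfl⟩
      · rw [hwe] at h4
        exact h4.elim
    choose a b ha hb using this
    simp only [ha, hb] at h1 h2 h5 h6
    exact ⟨a, b, h6, h5, fun i j hij => ⟨h1 i j hij, h2 i j hij⟩⟩

end OrderPreserving

end SignRankGraphs

/-! ### Stable order-preserving bipartite graphs -/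

namespace SignRankGraphs

section Stable

variable {X Y : Type} {M : X → Y → Prop} {p : X → ℝ} {q : Y → ℝ} {A : Set X} {B : Set Y}

/-- `d` is an upper bound on the depth needed for all order-preserving bipartite graphs without
chains of length `k`. -/
def ChainBound (k d : ℕ) : Prop :=
  ∀ (X Y : Type) [Finite X] [Finite Y] (M : X → Y → Prop) (p : X → ℝ) (q : Y → ℝ) (A : Set X)
    (B : Set Y), OrderPreserving M p q → ¬ HasChainOn M A B k → EqCompOn d A B M

/-- The finite set of bags that lie above the bag of `u` and contain a neighbour of `u` among the
vertices in `S`. -/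
noncomputable def upBags {V : Type} [Finite V] (E : V → V → Prop) (S : Set V) (L : V → List V)
    (u : V) : Finset (List V) :=
  ((Set.finite_range L).subset
    (show {l | l ≠ [] ∧ l <:+ L u ∧ u ∈ S ∧ ∃ w ∈ S, E u w ∧ L w = l} ⊆ Set.range L from
      fun _ ⟨_, _, _, w, _, _, h⟩ => ⟨w, h⟩)).toFinset

theorem mem_upBags {V : Type} [Finite V] {E : V → V → Prop} {S : Set V} {L : V → List V} {u : V}
    {l : List V} : l ∈ upBags E S L u ↔
      l ≠ [] ∧ l <:+ L u ∧ u ∈ S ∧ ∃ w ∈ S, E u w ∧ L w = l := by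
  simp [upBags]

/-- Between a bag `t` and the vertices below it that have neighbours in it the chains are shorter:
a chain is extended by the hook of the bag, which is adjacent to the whole bag, and by the parent
of the hook, which is adjacent to none of the vertices below. The isolated vertex `z` stands in for
the parent of a root. -/
theorem EqCompOn.of_isolated [Finite X] [Finite Y] {k d : ℕ} (hd : ChainBound k d)
    (hM : OrderPreserving M p q) {z : Y} (hz : z ∈ B) (hzA : ∀ x ∈ A, ¬ M x z)
    (hk : ¬ HasChainOn M A B (k + 1)) : EqCompOn (d + 16 * (k + 1) + 7) A B M := by
  set S : Set (X ⊕ Y) := {v | Sum.elim (· ∈ A) (· ∈ B) v}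
  obtain ⟨L, hL, hroot⟩ := exists_isGyarfas (sumAdj_symm M) (sumAdj_irrefl M) S
    {v | v.isLeft = true} (by
      intro a b h
      have := sumAdj_side a b h
      cases ha : a.isLeft
      · right
        simpa [ha] using this
      · exact Or.inl ha)
  have hAS : ∀ x, Sum.inl x ∈ S ↔ x ∈ A := fun x => Iff.rfl
  have hBS : ∀ y, Sum.inr y ∈ S ↔ y ∈ B := fun y => Iff.rfl
  have hcard : ∀ u, (upBags (sumAdj M) S L u).card ≤ 8 * (k + 1) + 2 := by
    intro u
    by_cases hu : u ∈ S
    · refine hL.card_le hM hk u hu _ fun l hl => ?_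
      obtain ⟨h1, h2, -, h3⟩ := mem_upBags.1 hl
      exact ⟨h1, h2, h3⟩
    · have : upBags (sumAdj M) S L u = ∅ := by
        ext l
        simp [mem_upBags, hu]
      simp [this]
  -- bags of columns, seen from the rows below
  have hX : ∀ t, EqCompOn d {x | t ∈ upBags (sumAdj M) S L (Sum.inl x)}
      {y | y ∈ B ∧ L (Sum.inr y) = t} M := by
    intro t
    by_cases hne : ∃ x₀ y₀, t ∈ upBags (sumAdj M) S L (Sum.inl x₀) ∧ y₀ ∈ B ∧ L (Sum.inr y₀) = t
    swap
    · refine ⟨fun _ _ => False, (EqComp.const False).mono (Nat.zero_le d), fun x hx y hy => ?_⟩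
      exact absurd ⟨x, y, hx, hy⟩ hne
    obtain ⟨x₀, y₀, hx₀, hy₀, hLy₀⟩ := hne
    have htne := (mem_upBags.1 hx₀).1
    refine hd X Y M p q _ _ hM fun hch => hk ?_
    obtain ⟨h, t', rfl⟩ := List.exists_cons_of_ne_nil htne
    have hh := hL.of_eq_cons ((hBS y₀).2 hy₀) hLy₀
    rcases h with hx | hy
    swap
    · exact hh.2.2.1.elim
    have hadj : ∀ y ∈ {y | y ∈ B ∧ L (Sum.inr y) = Sum.inl hx :: t'},
        M hx y := fun y hy =>
      (hL.of_eq_cons ((hBS y).2 hy.1) hy.2).2.2.1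
    obtain ⟨g, hgB, hg⟩ : ∃ g ∈ B, ∀ x ∈ {x | Sum.inl hx :: t' ∈ upBags (sumAdj M) S L (Sum.inl x)},
        ¬ M x g := by
      rcases t' with _ | ⟨g, t''⟩
      · exact ⟨z, hz, fun x hx => hzA x ((hAS x).1 (mem_upBags.1 hx).2.2.1)⟩
      · have hg := hL.of_eq_cons hh.1 hh.2.1
        rcases g with g | g
        · exact hg.2.2.1.elim
        · refine ⟨g, hg.1, fun x hx => ?_⟩
          obtain ⟨-, hsuf, hxS, -⟩ := mem_upBags.1 hx
          refine hL.not_adj (u := Sum.inl x) (x := Sum.inr g) hxS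
            ((List.suffix_cons _ _).trans hsuf) ?_
          have := hsuf.length_le
          simp only [List.length_cons] at this
          omega
    refine (hch.cons hadj hg).mono ?_ ?_
    · rintro x (rfl | hx)
      · exact hh.1
      · exact (mem_upBags.1 hx).2.2.1
    · rintro y (rfl | hy)
      · exact hgB
      · exact hy.1
  -- bags of rows, seen from the columns below
  have hY : ∀ t, EqCompOn d {x | x ∈ A ∧ L (Sum.inl x) = t}
      {y | t ∈ upBags (sumAdj M) S L (Sum.inr y)} M := by
    intro t
    by_cases hne : ∃ x₀ y₀, t ∈ upBags (sumAdj M) S L (Sum.inr y₀) ∧ x₀ ∈ A ∧ L (Sum.inl x₀) = t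
    swap
    · refine ⟨fun _ _ => False, (EqComp.const False).mono (Nat.zero_le d), fun x hx y hy => ?_⟩
      exact absurd ⟨x, y, hy, hx⟩ hne
    obtain ⟨x₀, y₀, hy₀, hx₀, hLx₀⟩ := hne
    have htne := (mem_upBags.1 hy₀).1
    refine hd X Y M p q _ _ hM fun hch => hk ?_
    obtain ⟨h, t', rfl⟩ := List.exists_cons_of_ne_nil htne
    have hh := hL.of_eq_cons ((hAS x₀).2 hx₀) hLx₀
    rcases h with hx | hy
    · exact hh.2.2.1.elim
    have hadj : ∀ x ∈ {x | x ∈ A ∧ L (Sum.inl x) = Sum.inr hy :: t'},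
        M x hy := fun x hx =>
      (hL.of_eq_cons ((hAS x).2 hx.1) hx.2).2.2.1
    obtain ⟨g, hgA, hg⟩ : ∃ g ∈ A, ∀ y ∈ {y | Sum.inr hy :: t' ∈ upBags (sumAdj M) S L (Sum.inr y)},
        ¬ M g y := by
      rcases t' with _ | ⟨g, t''⟩
      · -- the hook is not a root, since the roots of nontrivial components are rows
        rcases hroot _ hh.1 hh.2.1 with h | h
        · exact absurd h (by simp)
        · exact absurd hh.2.2.1 (h _ ((hAS x₀).2 hx₀))
      · have hg := hL.of_eq_cons hh.1 hh.2.1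
        rcases g with g | g
        · refine ⟨g, hg.1, fun y hy => ?_⟩
          obtain ⟨-, hsuf, hyS, -⟩ := mem_upBags.1 hy
          refine hL.not_adj (u := Sum.inr y) (x := Sum.inl g) hyS
            ((List.suffix_cons _ _).trans hsuf) ?_
          have := hsuf.length_le
          simp only [List.length_cons] at this
          omega
        · exact hg.2.2.1.elim
    refine (hch.snoc hg hadj).mono ?_ ?_
    · rintro x (rfl | hx)
      · exact hgA
      · exact hx.1
    · rintro y (rfl | hy)
      · exact hh.1
      · exact (mem_upBags.1 hy).2.2.1
  obtain ⟨N₁, hN₁, e₁⟩ := EqComp.glue_finset_right ((EqComp.const False).mono (Nat.zero_le d)) A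
    (fun x => L (Sum.inl x)) _ (fun y => upBags (sumAdj M) S L (Sum.inr y)) (fun y => hcard _) hY
  obtain ⟨N₂, hN₂, e₂⟩ := EqComp.glue_finset hN₁ B
    (fun y => L (Sum.inr y)) _ (fun x => upBags (sumAdj M) S L (Sum.inl x)) (fun x => hcard _)
    (fun t => (hX t).mono (by omega))
  refine ⟨_, (EqComp.node (fun x => [Sum.inl x]) (fun y => L (Sum.inr y))
    ((EqComp.const True).mono (Nat.zero_le _)) hN₂).mono (by omega), fun x hx y hy => ?_⟩
  have hxS := (hAS x).2 hx
  have hyS := (hBS y).2 hy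
  by_cases h0 : [Sum.inl x] = L (Sum.inr y)
  · simp only [h0, true_and, ne_eq, not_true_eq_false, false_and, or_false, true_iff]
    exact (hL.of_eq_cons hyS h0.symm).2.2.1
  simp only [h0, false_and, ne_eq, not_false_eq_true, true_and, false_or]
  obtain ⟨e₂a, e₂b⟩ := e₂ x y hy
  obtain ⟨e₁a, e₁b⟩ := e₁ x hx y
  by_cases h2 : L (Sum.inr y) ∈ upBags (sumAdj M) S L (Sum.inl x)
  · exact e₂a h2
  rw [e₂b h2]
  by_cases h1 : L (Sum.inl x) ∈ upBags (sumAdj M) S L (Sum.inr y)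
  · exact e₁a h1
  rw [e₁b h1]
  refine ⟨False.elim, fun hxy => ?_⟩
  have hyx : sumAdj M (Sum.inr y) (Sum.inl x) := hxy
  rcases hL.edge _ hxS _ hyS hxy with h | h
  · refine h1 (mem_upBags.2 ⟨fun hnil => h0 ?_, h, hyS, _, hxS, hyx, rfl⟩)
    exact (hL.root _ hxS hnil _ hyS hxy).symm
  · refine h2 (mem_upBags.2 ⟨fun hnil => ?_, h, hxS, _, hyS, hxy, rfl⟩)
    rcases hroot _ hyS hnil with h | h
    · exact absurd h (by simp)
    · exact h _ hxS hyx

/-- Stable order-preserving bipartite graphs are computed in bounded depth. An isolated vertex is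
made available by splitting the rows according to a column `z`, and taking the complement on the
rows adjacent to `z`. -/
theorem exists_chainBound (k : ℕ) : ∃ d, ChainBound k d := by
  induction k with
  | zero =>
    exact ⟨0, fun X Y _ _ M p q A B _ h => absurd
      ⟨Fin.elim0, Fin.elim0, fun i => i.elim0, fun i => i.elim0, fun i => i.elim0⟩ h⟩
  | succ k ih =>
    obtain ⟨d, hd⟩ := ih
    refine ⟨d + 16 * (k + 1) + 7 + 1, fun X Y _ _ M p q A B hM hk => ?_⟩
    rcases B.eq_empty_or_nonempty with rfl | ⟨z, hz⟩
    · exact ⟨fun _ _ => False, (EqComp.const False).mono (Nat.zero_le _), by simp⟩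
    refine EqCompOn.split_left (fun x => M x z) ?_ ?_
    · have hk' : ¬ HasChainOn (fun x y => ¬ M x y) {x | x ∈ A ∧ M x z} B (k + 1) := fun h => by
        have := (h.mono (Set.sep_subset _ _) subset_rfl).not
        simp only [not_not] at this
        exact hk this
      obtain ⟨N, hN, h⟩ := EqCompOn.of_isolated hd hM.not hz (fun x hx => not_not.2 hx.2) hk'
      exact ⟨_, hN.not, fun x hx y hy => by rw [h x hx y hy, not_not]⟩
    · exact EqCompOn.of_isolated hd hM hz (fun x hx => hx.2)
        fun h => hk (h.mono (Set.sep_subset _ _) subset_rfl)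

end Stable

/-! ### Matrices of rank three -/

/-- The rows `a x` and columns `v y` are the slopes of the lines and the abscissae of the points in
an arrangement of points and halfplanes. -/
theorem orderPreserving_of_eq {X Y : Type} (a c : X → ℝ) (v w : Y → ℝ) :
    OrderPreserving (fun x y => 0 ≤ a x * v y + w y + c x) a v := by
  intro x y x' y' h1 h2 h3 h4
  have h : 0 < (a x' - a x) * (v y' - v y) := by
    push Not at h3 h4
    nlinarith
  rcases mul_pos_iff.1 h with h | h
  · exact Or.inl ⟨by linarith, by linarith⟩
  · exact Or.inr ⟨by linarith, by linarith⟩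

theorem exists_mul_eq_of_rank_le {X Y : Type} [Fintype X] [Fintype Y] (R : Matrix X Y ℝ) {r : ℕ}
    (hR : R.rank ≤ r) :
    ∃ (u : Fin r → X → ℝ) (v : Fin r → Y → ℝ), ∀ x y, R x y = ∑ i, u i x * v i y := by
  classical
  let W := LinearMap.range R.mulVecLin
  have hfin : Module.finrank ℝ W ≤ r := hR
  let b := Module.finBasis ℝ W
  have hmem : ∀ y, R.col y ∈ W := fun y => ⟨Pi.single y 1, by simp⟩
  refine ⟨fun i x => if h : (i : ℕ) < Module.finrank ℝ W then (b ⟨i, h⟩ : X → ℝ) x else 0,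
    fun i y => if h : (i : ℕ) < Module.finrank ℝ W then b.repr ⟨R.col y, hmem y⟩ ⟨i, h⟩ else 0,
    fun x y => ?_⟩
  have h1 : R x y = ∑ j, (b j : X → ℝ) x * b.repr ⟨R.col y, hmem y⟩ j := by
    have h := congrArg (fun w : W => (w : X → ℝ) x) (b.sum_repr ⟨R.col y, hmem y⟩)
    simp only [Submodule.coe_sum, Submodule.coe_smul, Finset.sum_apply, Pi.smul_apply,
      smul_eq_mul] at h
    rw [Matrix.col_apply] at h
    rw [← h]
    exact Finset.sum_congr rfl fun j _ => mul_comm _ _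
  rw [h1]
  refine Finset.sum_of_injOn (Fin.castLE hfin) (Fin.castLE_injective hfin).injOn (by simp) ?_ ?_
  · intro i _ hi
    have : ¬ (i : ℕ) < Module.finrank ℝ W := fun h => hi ⟨⟨i, h⟩, by simp, by ext; simp⟩
    simp [this]
  · intro j _
    simp

/-- A matrix of rank at most `3` is reduced to an arrangement of points and halfplanes by
normalizing one coordinate of the rows and another one of the columns, which is possible on each
of nine blocks. -/
theorem exists_eqComp_of_rank_le_three (k : ℕ) : ∃ d, ∀ (X Y : Type) [Fintype X] [Fintype Y]
    (R : Matrix X Y ℝ), R.rank ≤ 3 →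
      ¬ HasChainOn (fun x y => 0 ≤ R x y) Set.univ Set.univ k →
      EqComp d fun x y => 0 ≤ R x y := by
  obtain ⟨d, hd⟩ := exists_chainBound k
  refine ⟨d + 4, fun X Y _ _ R hR hk => ?_⟩
  obtain ⟨u, v, huv⟩ := exists_mul_eq_of_rank_le R hR
  set M : X → Y → Prop := fun x y => 0 ≤ R x y
  have block : ∀ σ τ : ℝ, ∀ (A : Set X) (B : Set Y),
      (∀ x ∈ A, ∃ l : ℝ, 0 < l ∧ l * u 1 x = σ) → (∀ y ∈ B, ∃ l : ℝ, 0 < l ∧ l * v 2 y = τ) →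
      EqCompOn d A B M := by
    intro σ τ A B hA hB
    choose! l hl hlσ using hA
    choose! m hm hmτ using hB
    have hMM : ∀ x ∈ A, ∀ y ∈ B, (M x y ↔
        0 ≤ (l x * u 0 x) * (m y * v 0 y) + σ * (m y * v 1 y) + τ * (l x * u 2 x)) := by
      intro x hx y hy
      have : (l x * u 0 x) * (m y * v 0 y) + σ * (m y * v 1 y) + τ * (l x * u 2 x) =
          (l x * m y) * R x y := by
        rw [huv, Fin.sum_univ_three, ← hlσ x hx, ← hmτ y hy]
        ring
      rw [this, mul_nonneg_iff_of_pos_left (mul_pos (hl x hx) (hm y hy))]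
    obtain ⟨N, hN, h⟩ := hd X Y _ _ _ A B (orderPreserving_of_eq (fun x => l x * u 0 x)
      (fun x => τ * (l x * u 2 x)) (fun y => m y * v 0 y) fun y => σ * (m y * v 1 y))
      (by
        rintro ⟨a, b, ha, hb, h⟩
        refine hk ⟨a, b, fun _ => trivial, fun _ => trivial, fun i j hij => ?_⟩
        rw [hMM _ (ha i) _ (hb j), hMM _ (ha j) _ (hb i)]
        exact h i j hij)
    exact ⟨N, hN, fun x hx y hy => (h x hx y hy).trans (hMM x hx y hy).symm⟩
  have norm_pos : ∀ s : ℝ, 0 < s → ∃ l : ℝ, 0 < l ∧ l * s = 1 := fun s hs =>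
    ⟨s⁻¹, inv_pos.2 hs, inv_mul_cancel₀ hs.ne'⟩
  have norm_neg : ∀ s : ℝ, s < 0 → ∃ l : ℝ, 0 < l ∧ l * s = -1 := fun s hs =>
    ⟨(-s)⁻¹, inv_pos.2 (neg_pos.2 hs), by rw [inv_neg, neg_mul, inv_mul_cancel₀ hs.ne]⟩
  have norm_zero : ∀ s : ℝ, ¬ 0 < s → ¬ s < 0 → ∃ l : ℝ, 0 < l ∧ l * s = 0 := fun s h h' =>
    ⟨1, one_pos, by rw [one_mul]; exact le_antisymm (not_lt.1 h) (not_lt.1 h')⟩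
  have rows : ∀ τ : ℝ, ∀ B : Set Y, (∀ y ∈ B, ∃ l : ℝ, 0 < l ∧ l * v 2 y = τ) →
      EqCompOn (d + 2) Set.univ B M := by
    intro τ B hB
    refine EqCompOn.split_left (fun x => 0 < u 1 x)
      ((block 1 τ _ B (fun x hx => norm_pos _ hx.2) hB).mono (Nat.le_succ d))
      (EqCompOn.split_left (fun x => u 1 x < 0)
        (block (-1) τ _ B (fun x hx => norm_neg _ hx.2) hB)
        (block 0 τ _ B (fun x hx => norm_zero _ hx.1.2 hx.2) hB))
  obtain ⟨N, hN, h⟩ : EqCompOn (d + 4) Set.univ Set.univ M :=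
    EqCompOn.split_right (fun y => 0 < v 2 y)
      ((rows 1 _ (fun y hy => norm_pos _ hy.2)).mono (Nat.le_succ _))
      (EqCompOn.split_right (fun y => v 2 y < 0)
        (rows (-1) _ (fun y hy => norm_neg _ hy.2))
        (rows 0 _ (fun y hy => norm_zero _ hy.1.2 hy.2)))
  exact hN.congr fun x y => (h x trivial y trivial).symm

end SignRankGraphs

/-! ### Protocols with equality oracles -/

namespace SignRankGraphs

section Protocols

theorem QS.exists_eq_iff {m n : ℕ} {Q : Matrix (Fin m) (Fin n) ℤˣ} (h : QS Equality Q) :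
    ∃ (f : Fin m → ℕ) (g : Fin n → ℕ), ∀ i j, Q i j = 1 ↔ f i = g j := by
  induction h with
  | base h =>
    refine ⟨fun i => i, fun j => j, fun i j => ?_⟩
    rw [h.2]
    split_ifs with h <;> simp [h]
  | perm σ τ _ ih =>
    obtain ⟨f, g, h⟩ := ih
    exact ⟨f ∘ σ, g ∘ τ, fun i j => h _ _⟩
  | sub σ τ _ ih =>
    obtain ⟨f, g, h⟩ := ih
    exact ⟨f ∘ σ, g ∘ τ, fun i j => h _ _⟩
  | dupRow r _ ih =>
    obtain ⟨f, g, h⟩ := ih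
    exact ⟨f ∘ Fin.cons r id, g, fun i j => h _ _⟩
  | dupCol c _ ih =>
    obtain ⟨f, g, h⟩ := ih
    exact ⟨f, g ∘ Fin.cons c id, fun i j => h _ _⟩

/-- An arbitrary map `f` is obtained from the identity by prepending repeated values one by one and
then passing to a subsequence. -/
theorem induction_duplicate {m : ℕ} (P : ∀ r : ℕ, (Fin r → Fin m) → Prop) (hid : P m id)
    (hdup : ∀ r e s, P r e → P (r + 1) (e ∘ Fin.cons s id))
    (hsub : ∀ r k e (ι : Fin k ↪o Fin r), P r e → P k (e ∘ ι)) (k : ℕ) (f : Fin k → Fin m) :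
    P k f := by
  have key : ∀ (k : ℕ) (f : Fin k → Fin m), ∃ (r : ℕ) (e : Fin r → Fin m) (ι : Fin k ↪o Fin r),
      Function.Surjective e ∧ P r e ∧ e ∘ ι = f := by
    intro k
    induction k with
    | zero =>
      intro f
      exact ⟨m, id, OrderEmbedding.ofIsEmpty, Function.surjective_id, hid, Subsingleton.elim _ _⟩
    | succ k ih =>
      intro f
      obtain ⟨r, e, ι, he, hP, hf⟩ := ih (Fin.tail f)
      obtain ⟨s, hs⟩ := he (f 0)
      refine ⟨r + 1, e ∘ Fin.cons s id, OrderEmbedding.ofStrictMono (Fin.cons 0 (Fin.succ ∘ ι)) ?_,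
        fun y => ?_, hdup r e s hP, ?_⟩
      · intro i j hij
        obtain ⟨j, rfl⟩ := Fin.exists_succ_eq.2 (Fin.ne_zero_of_lt hij)
        revert hij
        refine Fin.cases (fun _ => by simp) (fun i hij => ?_) i
        simpa using hij
      · obtain ⟨x, hx⟩ := he y
        exact ⟨x.succ, by simpa using hx⟩
      · funext i
        refine Fin.cases hs (fun i => ?_) i
        exact congrFun hf i
  obtain ⟨r, e, ι, -, hP, rfl⟩ := key k f
  exact hsub r k e ι hP

theorem QS.submatrix {𝓑 : MatrixSet} {m n k l : ℕ} {Q : Matrix (Fin m) (Fin n) ℤˣ}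
    (h : QS 𝓑 Q) (f : Fin k → Fin m) (g : Fin l → Fin n) : QS 𝓑 (Q.submatrix f g) := by
  have h₁ : QS 𝓑 (Q.submatrix f id) :=
    induction_duplicate (fun _ f => QS 𝓑 (Q.submatrix f id)) h (fun _ _ s hQ => QS.dupRow s hQ)
      (fun _ _ _ ι hQ => QS.sub ι (OrderIso.refl _).toOrderEmbedding hQ) k f
  exact induction_duplicate (fun _ g => QS 𝓑 (Q.submatrix f g)) h₁ (fun _ _ s hQ => QS.dupCol s hQ)
    (fun _ _ _ ι hQ => QS.sub (OrderIso.refl _).toOrderEmbedding ι hQ) l g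

/-- Every query `f x = g y` is an equality query. -/
theorem QS.of_eq_iff {m n : ℕ} {T : Type} [DecidableEq T] (f : Fin m → T) (g : Fin n → T) :
    QS Equality (fun i j => if f i = g j then 1 else -1) := by
  let s : Finset T := Finset.univ.image f ∪ Finset.univ.image g
  have hf : ∀ i, f i ∈ s := fun i => Finset.mem_union_left _ (by simp)
  have hg : ∀ j, g j ∈ s := fun j => Finset.mem_union_right _ (by simp)
  have hbase : QS Equality
      (fun i j : Fin s.card => if (i : ℕ) = (j : ℕ) then (1 : ℤˣ) else -1) :=
    QS.base ⟨rfl, fun _ _ => rfl⟩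
  have heq : (fun (i : Fin m) (j : Fin n) => if f i = g j then (1 : ℤˣ) else -1) =
      Matrix.submatrix (fun i j : Fin s.card => if (i : ℕ) = (j : ℕ) then (1 : ℤˣ) else -1)
        (fun i => s.equivFin ⟨f i, hf i⟩) (fun j => s.equivFin ⟨g j, hg j⟩) := by
    funext i j
    change _ = if (s.equivFin ⟨f i, hf i⟩ : ℕ) = (s.equivFin ⟨g j, hg j⟩ : ℕ) then (1 : ℤˣ) else -1
    simp [Fin.val_inj]
  rw [heq]
  exact hbase.submatrix _ _

theorem exists_protocol_of_eqComp {m n d : ℕ} : ∀ {M : Fin m → Fin n → Prop}, EqComp d M →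
    ∃ T : Protocol m n, T.UsesOracle Equality ∧ T.depth ≤ d + 1 ∧
      ∀ x y, T.output x y = 1 ↔ M x y := by
  classical
  have h1 : (1 : ℤˣ) ≠ -1 := by decide
  have h2 : (-1 : ℤˣ) ≠ 1 := by decide
  induction d with
  | zero =>
    rintro M ⟨φ, hφ⟩
    refine ⟨.node (fun x _ => if decide (φ x) = true then 1 else -1) (.leaf (-1)) (.leaf 1),
      ⟨QS.of_eq_iff (fun x => decide (φ x)) fun _ => true, trivial, trivial⟩, by simp [Protocol.depth], fun x y => ?_⟩
    by_cases h : φ x <;> simp [Protocol.output, h, hφ, h1, h2]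
  | succ d ih =>
    rintro M ⟨T, f, g, M₁, M₂, hM₁, hM₂, hM⟩
    obtain ⟨T₁, o₁, d₁, e₁⟩ := ih hM₁
    obtain ⟨T₂, o₂, d₂, e₂⟩ := ih hM₂
    refine ⟨.node (fun x y => if f x = g y then 1 else -1) T₂ T₁, ⟨QS.of_eq_iff f g, o₂, o₁⟩,
      by simp [Protocol.depth, d₁, d₂], fun x y => ?_⟩
    rw [hM]
    by_cases h : f x = g y <;> simp [Protocol.output, h, h1, e₁, e₂]

theorem oracleCost_le_of_eqComp {m n d : ℕ} {P : Matrix (Fin m) (Fin n) ℤˣ}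
    (h : EqComp d fun x y => P x y = 1) : oracleCost Equality P ≤ (d + 1 : ℕ) := by
  obtain ⟨T, o, hd, e⟩ := exists_protocol_of_eqComp h
  refine (iInf₂_le T ⟨o, fun x y => ?_⟩).trans (by exact_mod_cast hd)
  rcases Int.units_eq_one_or (P x y) with hP | hP
  · rw [hP, e, hP]
  · rw [hP]
    refine (Int.units_eq_one_or _).resolve_left fun h' => ?_
    rw [e, hP] at h'
    exact absurd h' (by decide)

theorem exists_protocol_of_oracleCost_le {𝓑 : MatrixSet} {m n d : ℕ}
    {P : Matrix (Fin m) (Fin n) ℤˣ} (h : oracleCost 𝓑 P ≤ d) :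
    ∃ T : Protocol m n, T.UsesOracle 𝓑 ∧ T.depth ≤ d ∧ ∀ x y, T.output x y = P x y := by
  have : oracleCost 𝓑 P < (d + 1 : ℕ) := lt_of_le_of_lt h (by exact_mod_cast Nat.lt_succ_self d)
  simp only [oracleCost, iInf_lt_iff] at this
  obtain ⟨T, ⟨o, e⟩, hT⟩ := this
  exact ⟨T, o, Nat.lt_succ_iff.1 (by exact_mod_cast hT), e⟩

end Protocols

/-! ### Long chains need deep protocols -/

section LowerBound

/-- If no value of `f` or `g` is taken more than `D` times on `S`, then a fraction of `S` is free
of coincidences `f i = g j` with `i ≠ j`. -/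
theorem exists_subset_forall_ne {ι T : Type} [DecidableEq ι] [DecidableEq T] (f g : ι → T)
    (D : ℕ) (n : ℕ) :
    ∀ S : Finset ι, S.card ≤ n → (∀ t, (S.filter fun i => f i = t).card ≤ D) →
      (∀ t, (S.filter fun i => g i = t).card ≤ D) →
      ∃ S' ⊆ S, S.card ≤ (2 * D + 1) * S'.card ∧ ∀ i ∈ S', ∀ j ∈ S', i ≠ j → f i ≠ g j := by
  induction n with
  | zero =>
    intro S hS _ _
    exact ⟨∅, Finset.empty_subset _, by simpa using hS, by simp⟩
  | succ n ih =>
    intro S hS hf hg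
    rcases S.eq_empty_or_nonempty with rfl | ⟨i, hi⟩
    · exact ⟨∅, Finset.empty_subset _, by simp, by simp⟩
    set S₁ := (S.erase i).filter fun j => f j ≠ g i ∧ g j ≠ f i with hS₁
    have hsub : S₁ ⊆ S := (Finset.filter_subset _ _).trans (Finset.erase_subset _ _)
    have hcard : S.card ≤ S₁.card + (2 * D + 1) := by
      have h1 : S ⊆ S₁ ∪ ({i} ∪ ((S.filter fun j => f j = g i) ∪
          (S.filter fun j => g j = f i))) := by
        intro j hj
        simp only [hS₁, Finset.mem_union, Finset.mem_filter, Finset.mem_erase,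
          Finset.mem_singleton]
        tauto
      have h2 := Finset.card_le_card h1
      have h3 := Finset.card_union_le S₁ ({i} ∪ ((S.filter fun j => f j = g i) ∪
          (S.filter fun j => g j = f i)))
      have h4 := Finset.card_union_le {i} ((S.filter fun j => f j = g i) ∪
          (S.filter fun j => g j = f i))
      have h5 := Finset.card_union_le (S.filter fun j => f j = g i) (S.filter fun j => g j = f i)
      have h6 := hf (g i)
      have h7 := hg (f i)
      rw [Finset.card_singleton] at h4
      omega
    have hlt : S₁.card < S.card := Finset.card_lt_card ⟨hsub, fun h => by
      have := h hi
      simp [hS₁] at this⟩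
    obtain ⟨S₂, h₂, hc, hne⟩ := ih S₁ (by omega)
      (fun t => (Finset.card_le_card (Finset.filter_subset_filter _ hsub)).trans (hf t))
      (fun t => (Finset.card_le_card (Finset.filter_subset_filter _ hsub)).trans (hg t))
    have hi₂ : i ∉ S₂ := fun h => by simpa [hS₁] using h₂ h
    refine ⟨insert i S₂, Finset.insert_subset hi (h₂.trans hsub), ?_, ?_⟩
    · rw [Finset.card_insert_of_notMem hi₂]
      linarith
    · intro a ha b hb hab
      rcases Finset.mem_insert.1 ha with rfl | ha' <;> rcases Finset.mem_insert.1 hb with rfl | hb'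
      · exact absurd rfl hab
      · exact fun e => (Finset.mem_filter.1 (h₂ hb')).2.2 e.symm
      · exact (Finset.mem_filter.1 (h₂ ha')).2.1
      · exact hne a ha' b hb' hab

/-- Every equality query is constant on the off-diagonal pairs of a large set of indices. -/
theorem exists_subset_homogeneous {ι T : Type} [DecidableEq ι] [DecidableEq T] (f g : ι → T)
    (n : ℕ) (S : Finset ι) (hS : (4 * n + 1) * n ≤ S.card) :
    ∃ S' ⊆ S, n ≤ S'.card ∧ ((∀ i ∈ S', ∀ j ∈ S', i ≠ j → f i = g j) ∨
      ∀ i ∈ S', ∀ j ∈ S', i ≠ j → f i ≠ g j) := by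
  by_cases hf : ∃ t, 2 * n < (S.filter fun i => f i = t).card
  · obtain ⟨t, ht⟩ := hf
    set S₁ := S.filter fun i => f i = t with hS₁
    have hc := Finset.card_filter_add_card_filter_not (s := S₁) (fun i => g i = t)
    by_cases h : n ≤ (S₁.filter fun i => g i = t).card
    · refine ⟨_, (Finset.filter_subset _ _).trans (Finset.filter_subset _ _), h, Or.inl ?_⟩
      intro i hi j hj _
      simp only [Finset.mem_filter] at hi hj
      rw [hi.1.2, hj.2]
    · refine ⟨S₁.filter fun i => ¬ g i = t,
        (Finset.filter_subset _ _).trans (Finset.filter_subset _ _), by omega, Or.inr ?_⟩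
      intro i hi j hj _
      simp only [hS₁, Finset.mem_filter] at hi hj
      rw [hi.1.2]
      exact fun e => hj.2 e.symm
  by_cases hg : ∃ t, 2 * n < (S.filter fun i => g i = t).card
  · obtain ⟨t, ht⟩ := hg
    set S₁ := S.filter fun i => g i = t with hS₁
    have hc := Finset.card_filter_add_card_filter_not (s := S₁) (fun i => f i = t)
    by_cases h : n ≤ (S₁.filter fun i => f i = t).card
    · refine ⟨_, (Finset.filter_subset _ _).trans (Finset.filter_subset _ _), h, Or.inl ?_⟩
      intro i hi j hj _
      simp only [Finset.mem_filter] at hi hj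
      rw [hi.2, hj.1.2]
    · refine ⟨S₁.filter fun i => ¬ f i = t,
        (Finset.filter_subset _ _).trans (Finset.filter_subset _ _), by omega, Or.inr ?_⟩
      intro i hi j hj _
      simp only [hS₁, Finset.mem_filter] at hi hj
      rw [hj.1.2]
      exact hi.2
  push Not at hf hg
  obtain ⟨S', h, hc, hne⟩ := exists_subset_forall_ne f g (2 * n) S.card S le_rfl hf hg
  refine ⟨S', h, ?_, Or.inr hne⟩
  have h1 := hS.trans hc
  rw [show 2 * (2 * n) + 1 = 4 * n + 1 by ring] at h1
  exact Nat.le_of_mul_le_mul_left h1 (Nat.succ_pos _)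

/-- A shallow protocol cannot tell the pair `(i, j)` from the pair `(j, i)` for all `i ≠ j` in a
large set of indices of rows and columns. -/
theorem exists_chain_length (d : ℕ) : ∃ K : ℕ, ∀ {m n : ℕ} (T : Protocol m n),
    T.UsesOracle Equality → T.depth ≤ d → ∀ {ι : Type} [DecidableEq ι] (r : ι → Fin m)
      (c : ι → Fin n) (S : Finset ι), K ≤ S.card →
      ∃ i ∈ S, ∃ j ∈ S, i ≠ j ∧ T.output (r i) (c j) = T.output (r j) (c i) := by
  have leaf : ∀ {m n : ℕ} (b : ℤˣ) {ι : Type} [DecidableEq ι] (r : ι → Fin m)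
      (c : ι → Fin n) (S : Finset ι), 2 ≤ S.card → ∃ i ∈ S, ∃ j ∈ S, i ≠ j ∧
        (Protocol.leaf b).output (r i) (c j) = (Protocol.leaf b).output (r j) (c i) := by
    intro m n b ι _ r c S hS
    obtain ⟨i, hi, j, hj, hij⟩ := Finset.one_lt_card.1 hS
    exact ⟨i, hi, j, hj, hij, rfl⟩
  induction d with
  | zero =>
    refine ⟨2, fun {m n} T _ hT {ι} _ r c S hS => ?_⟩
    cases T with
    | leaf b => exact leaf b r c S hS
    | node Q T₁ T₂ => simp [Protocol.depth] at hT
  | succ d ih =>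
    obtain ⟨K, hK⟩ := ih
    refine ⟨(4 * K + 1) * K + 2, fun {m n} T o hT {ι} _ r c S hS => ?_⟩
    cases T with
    | leaf b => exact leaf b r c S (by omega)
    | node Q T₁ T₂ =>
      obtain ⟨oQ, o₁, o₂⟩ := o
      obtain ⟨f, g, hQ⟩ := oQ.exists_eq_iff
      simp only [Protocol.depth] at hT
      obtain ⟨S', hS', hc, h⟩ := exists_subset_homogeneous (f ∘ r) (g ∘ c) K S (by omega)
      rcases h with h | h
      · obtain ⟨i, hi, j, hj, hij, e⟩ := hK T₂ o₂ (by omega) r c S' hc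
        have q1 : Q (r i) (c j) = 1 := (hQ _ _).2 (h i hi j hj hij)
        have q2 : Q (r j) (c i) = 1 := (hQ _ _).2 (h j hj i hi hij.symm)
        have h1 : (1 : ℤˣ) ≠ -1 := by decide
        exact ⟨i, hS' hi, j, hS' hj, hij, by simp [Protocol.output, q1, q2, h1, e]⟩
      · obtain ⟨i, hi, j, hj, hij, e⟩ := hK T₁ o₁ (by omega) r c S' hc
        have q1 : Q (r i) (c j) = -1 := (Int.units_eq_one_or _).resolve_left fun e =>
          h i hi j hj hij ((hQ _ _).1 e)
        have q2 : Q (r j) (c i) = -1 := (Int.units_eq_one_or _).resolve_left fun e =>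
          h j hj i hi hij.symm ((hQ _ _).1 e)
        exact ⟨i, hS' hi, j, hS' hj, hij, by simp [Protocol.output, q1, q2, e]⟩

/-- Matrices of bounded cost contain no long chains of rows and columns, in either of the two
orientations. -/
theorem exists_chain_bound_of_oracleCost_le (d : ℕ) : ∃ K : ℕ, ∀ {m n : ℕ}
    (P : Matrix (Fin m) (Fin n) ℤˣ), oracleCost Equality P ≤ d → ∀ {k : ℕ} (r : Fin k → Fin m)
      (c : Fin k → Fin n), (∀ i j, i < j → P (r i) (c j) ≠ P (r j) (c i)) → k < K := by
  obtain ⟨K, hK⟩ := exists_chain_length d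
  refine ⟨K, fun {m n} P hP {k} r c h => ?_⟩
  by_contra! hk
  obtain ⟨T, o, hd, e⟩ := exists_protocol_of_oracleCost_le hP
  obtain ⟨i, -, j, -, hij, e'⟩ := hK T o hd r c Finset.univ (by simpa using hk)
  rw [e, e] at e'
  rcases lt_or_gt_of_ne hij with hij | hij
  · exact h i j hij e'
  · exact h j i hij e'.symm

end LowerBound

/-! ### Chains in graphs and in their matrices -/

section Chains

theorem HasChain.mono {V : Type*} {G : SimpleGraph V} {k l : ℕ} (h : HasChain G k) (hl : l ≤ k) :
    HasChain G l := by
  obtain ⟨a, b, ha, hb, hd, h⟩ := h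
  refine ⟨a ∘ Fin.castLE hl, b ∘ Fin.castLE hl, ha.comp (Fin.castLE_injective hl),
    hb.comp (Fin.castLE_injective hl), ?_, fun i j hij => h _ _ (by simpa using hij)⟩
  exact hd.mono (Set.range_comp_subset_range _ _) (Set.range_comp_subset_range _ _)

theorem chainIndex_le_iff {V : Type*} {G : SimpleGraph V} {k : ℕ} :
    chainIndex G ≤ k ↔ ¬ HasChain G (k + 1) := by
  constructor
  · intro h hc
    have h1 : ((k + 1 : ℕ) : ℕ∞) ≤ chainIndex G :=
      le_iSup₂ (f := fun (k : ℕ) (_ : HasChain G k) => (k : ℕ∞)) (k + 1) hc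
    have h2 : k + 1 ≤ k := by exact_mod_cast h1.trans h
    omega
  · intro h
    refine iSup₂_le fun l hl => ?_
    have : l ≤ k := by
      by_contra! hlt
      exact h (hl.mono hlt)
    exact_mod_cast this

/-- Sparse subsequences of the rows and columns of a chain are injective. If some rows and columns
are represented by the same objects, as `e` indicates, the columns can be chosen such that
corresponding rows and columns are represented by different objects: the columns next to a row on
its two sides are different. -/
theorem HasChainOn.exists_injective {X Y V : Type} {M : X → Y → Prop} {A : Set X} {B : Set Y}
    {k : ℕ} (h : HasChainOn M A B (4 * k)) (e : X → V) (e' : Y → V)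
    (he' : Function.Injective e') :
    ∃ (a : Fin k → X) (b : Fin k → Y), Function.Injective a ∧ Function.Injective b ∧
      (∀ i, e (a i) ≠ e' (b i)) ∧ ∀ i j, i < j → M (a i) (b j) ∧ ¬ M (a j) (b i) := by
  classical
  obtain ⟨a, b, -, -, h⟩ := h
  have h' : ∀ (i j : ℕ) (hi : i < 4 * k) (hj : j < 4 * k), i < j →
      M (a ⟨i, hi⟩) (b ⟨j, hj⟩) ∧ ¬ M (a ⟨j, hj⟩) (b ⟨i, hi⟩) := fun i j hi hj hij => h _ _ hij
  have hb : ∀ i : Fin k, ∃ t : ℕ, ∃ ht : t < 4 * k, (t = 4 * i ∨ t = 4 * i + 2) ∧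
      e (a ⟨4 * i + 1, by omega⟩) ≠ e' (b ⟨t, ht⟩) := by
    intro i
    by_cases hi : e (a ⟨4 * i + 1, by omega⟩) = e' (b ⟨4 * i, by omega⟩)
    · refine ⟨4 * i + 2, by omega, Or.inr rfl, fun hi' => ?_⟩
      have heq := he' (hi.symm.trans hi')
      have h1 := (h' (4 * i) (4 * i + 1) (by omega) (by omega) (by omega)).2
      have h2 := (h' (4 * i + 1) (4 * i + 2) (by omega) (by omega) (by omega)).1
      rw [heq] at h1
      exact h1 h2
    · exact ⟨4 * i, by omega, Or.inl rfl, hi⟩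
  choose t ht htc hne using hb
  have inj_of_lt : ∀ {Z : Type} (s : Fin k → Z), (∀ i j, i < j → s i ≠ s j) →
      Function.Injective s := by
    intro Z s hs i j hij
    rcases lt_trichotomy i j with hlt | heq | hlt
    · exact absurd hij (hs i j hlt)
    · exact heq
    · exact absurd hij.symm (hs j i hlt)
  refine ⟨fun i => a ⟨4 * i + 1, by omega⟩, fun i => b ⟨t i, ht i⟩, inj_of_lt _ ?_, inj_of_lt _ ?_,
    hne, ?_⟩
  · intro i j hij heq
    have hij' : (i : ℕ) < j := hij
    have h1 := (h' (4 * i + 1) (4 * i + 2) (by omega) (by omega) (by omega)).1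
    have h2 := (h' (4 * i + 2) (4 * j + 1) (by omega) (by omega) (by omega)).2
    rw [heq] at h1
    exact h2 h1
  · intro i j hij heq
    have hij' : (i : ℕ) < j := hij
    have := htc i
    have := htc j
    have h1 := (h' (t i) (4 * i + 3) (ht i) (by omega) (by omega)).2
    have h2 := (h' (4 * i + 3) (t j) (by omega) (ht j) (by omega)).1
    rw [heq] at h1
    exact h1 h2
  · intro i j hij
    have hij' : (i : ℕ) < j := hij
    have := htc i
    have := htc j
    exact ⟨(h' _ _ _ _ (by omega)).1, (h' _ _ _ _ (by omega)).2⟩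

theorem hasChain_of_hasChainOn {V : Type} {G : SimpleGraph V} {M : V → V → Prop}
    (hM : ∀ x y, x ≠ y → (M x y ↔ G.Adj x y)) {k : ℕ}
    (h : HasChainOn M Set.univ Set.univ (4 * (3 * k))) : HasChain G k := by
  classical
  obtain ⟨a, b, ha, hb, hab, hch⟩ := h.exists_injective id id Function.injective_id
  have fiber : ∀ (s : Fin (3 * k) → V), Function.Injective s → ∀ v,
      (Finset.univ.filter fun i => s i = v).card ≤ 1 := by
    intro s hs v
    refine Finset.card_le_one.2 fun i hi j hj => hs ?_
    rw [(Finset.mem_filter.1 hi).2, (Finset.mem_filter.1 hj).2]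
  obtain ⟨S, -, hS, hne⟩ := exists_subset_forall_ne a b 1 _ Finset.univ le_rfl (fiber a ha)
    (fiber b hb)
  have hk : k ≤ S.card := by
    rw [Finset.card_univ, Fintype.card_fin] at hS
    omega
  let ι : Fin k → Fin (3 * k) := fun i => S.orderEmbOfFin rfl (Fin.castLE hk i)
  have hι : ∀ i, ι i ∈ S := fun i => Finset.orderEmbOfFin_mem _ _ _
  have hιlt : ∀ i j, i < j → ι i < ι j := fun i j hij => by simpa [ι] using hij
  have hιinj : Function.Injective ι := (show StrictMono ι from hιlt).injective
  have hne' : ∀ i j, a (ι i) ≠ b (ι j) := by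
    intro i j
    by_cases hij : ι i = ι j
    · rw [hij]
      exact hab _
    · exact hne _ (hι i) _ (hι j) hij
  refine ⟨a ∘ ι, b ∘ ι, ha.comp hιinj, hb.comp hιinj, ?_, fun i j hij => ?_⟩
  · rw [Set.disjoint_left]
    rintro _ ⟨i, rfl⟩ ⟨j, hj⟩
    exact hne' i j hj.symm
  · have := hch _ _ (hιlt i j hij)
    rw [hM _ _ (hne' i j), hM _ _ (hne' j i)] at this
    exact ⟨this.1, fun h => this.2 h.symm⟩

theorem hasChain_toSimpleGraph {X Y : Type} {G : BipartiteGraph X Y} {k : ℕ}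
    (h : HasChainOn G.Adj Set.univ Set.univ (4 * k)) : HasChain G.toSimpleGraph k := by
  obtain ⟨a, b, ha, hb, -, hch⟩ := h.exists_injective Sum.inl Sum.inr Sum.inr_injective
  refine ⟨Sum.inl ∘ a, Sum.inr ∘ b, Sum.inl_injective.comp ha, Sum.inr_injective.comp hb, ?_,
    fun i j hij => ⟨Or.inl ⟨_, _, rfl, rfl, (hch i j hij).1⟩, ?_⟩⟩
  · rw [Set.disjoint_left]
    rintro _ ⟨i, rfl⟩ ⟨j, hj⟩
    simp at hj
  · rintro (⟨x, y, h1, -, -⟩ | ⟨x, y, h1, h2, h⟩)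
    · simp at h1
    · simp only [Function.comp_apply, Sum.inr.injEq, Sum.inl.injEq] at h1 h2
      subst h1 h2
      exact (hch i j hij).2 h

theorem adjacency_eq_one_iff {V : Type*} (G : SimpleGraph V) (x y : V) :
    adjacency G x y = 1 ↔ G.Adj x y := by
  unfold adjacency
  split_ifs with h <;> simp [h]

theorem BipartiteGraph.adjacency_eq_one_iff {X Y : Type*} (G : BipartiteGraph X Y) (x : X)
    (y : Y) : G.adjacency x y = 1 ↔ G.Adj x y := by
  unfold BipartiteGraph.adjacency
  split_ifs with h <;> simp [h]

theorem adjacency_ne_of_hasChain {V : Type*} {G : SimpleGraph V} {k : ℕ} (h : HasChain G k) :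
    ∃ r c : Fin k → V, ∀ i j, i < j → adjacency G (r i) (c j) ≠ adjacency G (r j) (c i) := by
  obtain ⟨a, b, -, -, -, h⟩ := h
  refine ⟨a, b, fun i j hij heq => ?_⟩
  have h1 := (adjacency_eq_one_iff G _ _).2 (h i j hij).1
  rw [heq, adjacency_eq_one_iff] at h1
  exact (h i j hij).2 h1.symm

theorem BipartiteGraph.toSimpleGraph_adj_inl_inr {X Y : Type*} {G : BipartiteGraph X Y} {x : X}
    {y : Y} : G.toSimpleGraph.Adj (Sum.inl x) (Sum.inr y) ↔ G.Adj x y := by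
  simp [BipartiteGraph.toSimpleGraph]

theorem BipartiteGraph.toSimpleGraph_adj_isLeft {X Y : Type*} {G : BipartiteGraph X Y}
    {u v : X ⊕ Y} (h : G.toSimpleGraph.Adj u v) : u.isLeft = !v.isLeft := by
  rcases h with ⟨x, y, rfl, rfl, -⟩ | ⟨x, y, rfl, rfl, -⟩ <;> rfl

/-- Apart from the ends of a chain in a bipartite graph, its two parts are on different sides; they
yield rows and columns, in one of the two orientations. -/
theorem BipartiteGraph.adjacency_ne_of_hasChain {X Y : Type*} {G : BipartiteGraph X Y} {k : ℕ}
    (h : HasChain G.toSimpleGraph (k + 2)) :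
    ∃ (r : Fin k → X) (c : Fin k → Y),
      ∀ i j, i < j → G.adjacency (r i) (c j) ≠ G.adjacency (r j) (c i) := by
  obtain ⟨a, b, -, -, -, h⟩ := h
  have hb : ∀ j, j ≠ 0 → (b j).isLeft = !(a 0).isLeft := fun j hj => by
    rw [toSimpleGraph_adj_isLeft (h 0 j (Fin.pos_of_ne_zero hj)).1, Bool.not_not]
  have ha : ∀ i, i ≠ Fin.last (k + 1) → (a i).isLeft = (a 0).isLeft := fun i hi => by
    rw [toSimpleGraph_adj_isLeft (h i (Fin.last _) (Fin.lt_last_iff_ne_last.2 hi)).1,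
      hb _ (Fin.last_pos.ne'), Bool.not_not]
  have ha' : ∀ i : Fin k, (a i.castSucc.succ).isLeft = (a 0).isLeft := fun i =>
    ha _ (by rw [Fin.succ_castSucc]; exact (Fin.castSucc_lt_last _).ne)
  have hb' : ∀ i : Fin k, (b i.castSucc.succ).isLeft = !(a 0).isLeft := fun i =>
    hb _ (Fin.succ_ne_zero _)
  have h' : ∀ i j : Fin k, i < j → G.toSimpleGraph.Adj (a i.castSucc.succ) (b j.castSucc.succ) ∧
      ¬ G.toSimpleGraph.Adj (b i.castSucc.succ) (a j.castSucc.succ) := fun i j hij =>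
    h _ _ (by simpa using hij)
  cases h0 : (a 0).isLeft
  · simp only [h0, Bool.not_false, Sum.isLeft_iff, Sum.isLeft_eq_false, Sum.isRight_iff] at ha' hb'
    choose c hc using ha'
    choose r hr using hb'
    refine ⟨r, c, fun i j hij heq => ?_⟩
    have h1 := h' i j hij
    rw [hc, hc, hr, hr, SimpleGraph.adj_comm, toSimpleGraph_adj_inl_inr, toSimpleGraph_adj_inl_inr,
      ← G.adjacency_eq_one_iff, ← G.adjacency_eq_one_iff, heq] at h1
    exact h1.2 h1.1
  · simp only [h0, Bool.not_true, Sum.isLeft_iff, Sum.isLeft_eq_false, Sum.isRight_iff] at ha' hb'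
    choose r hr using ha'
    choose c hc using hb'
    refine ⟨r, c, fun i j hij heq => ?_⟩
    have h1 := h' i j hij
    rw [hc, hc, hr, hr, G.toSimpleGraph.adj_comm (Sum.inr _), toSimpleGraph_adj_inl_inr,
      toSimpleGraph_adj_inl_inr, ← G.adjacency_eq_one_iff, ← G.adjacency_eq_one_iff, heq] at h1
    exact h1.2 h1.1

end Chains

/-! ### Graph classes of sign-rank at most three -/

section Classes

theorem sgn_eq_one_iff (r : ℝ) : sgn r = 1 ↔ 0 ≤ r := by
  unfold sgn
  split_ifs with h <;> simp [h]

theorem exists_of_signRank_le {X Y : Type} [Fintype Y] {M : Matrix X Y ℤˣ} {d : ℕ}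
    (h : signRank M ≤ d) : ∃ R : Matrix X Y ℝ, R.rank ≤ d ∧ ∀ x y, 0 ≤ R x y ↔ M x y = 1 := by
  have : signRank M < (d + 1 : ℕ) := lt_of_le_of_lt h (by exact_mod_cast Nat.lt_succ_self d)
  simp only [signRank, iInf_lt_iff] at this
  obtain ⟨R, hR, hd⟩ := this
  exact ⟨R, Nat.lt_succ_iff.1 (by exact_mod_cast hd), fun x y => by rw [← hR, sgn_eq_one_iff]⟩

theorem exists_of_partialSignRank_le {V : Type} [Fintype V] {G : SimpleGraph V} {d : ℕ}
    (h : partialSignRank (partialAdjacency G) ≤ d) :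
    ∃ R : Matrix V V ℝ, R.rank ≤ d ∧ ∀ x y, x ≠ y → (0 ≤ R x y ↔ G.Adj x y) := by
  have : partialSignRank (partialAdjacency G) < (d + 1 : ℕ) :=
    lt_of_le_of_lt h (by exact_mod_cast Nat.lt_succ_self d)
  simp only [partialSignRank, iInf_lt_iff] at this
  obtain ⟨R, hR, hd⟩ := this
  refine ⟨R, Nat.lt_succ_iff.1 (by exact_mod_cast hd), fun x y hxy => ?_⟩
  rw [← sgn_eq_one_iff]
  by_cases hadj : G.Adj x y
  · simp [hR x y 1 (by simp [partialAdjacency, hxy, hadj]), hadj]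
  · simp [hR x y (-1) (by simp [partialAdjacency, hxy, hadj]), hadj]

theorem GraphClass.stable_of_isConstantCost {𝒢 : GraphClass}
    (h : IsConstantCost 𝒢.equalityCost) : 𝒢.Stable := by
  obtain ⟨C, hC⟩ := h
  obtain ⟨K, hK⟩ := exists_chain_bound_of_oracleCost_le C
  refine ⟨K, fun N G hG => chainIndex_le_iff.2 fun hc => ?_⟩
  obtain ⟨r, c, hrc⟩ := adjacency_ne_of_hasChain hc
  have := hK (adjacency G) ((le_iSup₂ (f := fun G (_ : G ∈ 𝒢.graphs N) =>
    oracleCost Equality (adjacency G)) G hG).trans (hC N)) r c hrc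
  omega

theorem GraphClass.isConstantCost_of_stable {𝒢 : GraphClass} (hr : 𝒢.SignRankAtMost 3)
    (h : 𝒢.Stable) : IsConstantCost 𝒢.equalityCost := by
  obtain ⟨k, hk⟩ := h
  obtain ⟨d, hd⟩ := exists_eqComp_of_rank_le_three (4 * (3 * (k + 1)))
  refine ⟨d + 1 + 1, fun N => iSup₂_le fun G hG => ?_⟩
  obtain ⟨R, hR, hRG⟩ := exists_of_partialSignRank_le (d := 3) (hr N G hG)
  have hN := hd _ _ R hR fun hc => chainIndex_le_iff.1 (hk N G hG) (hasChain_of_hasChainOn hRG hc)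
  -- the diagonal is settled by the query `x = y`
  refine oracleCost_le_of_eqComp (d := d + 1) ((EqComp.node id id
    ((EqComp.const False).mono (Nat.zero_le d)) hN).congr fun x y => ?_)
  rw [adjacency_eq_one_iff]
  by_cases hxy : x = y
  · simp [hxy]
  · simp [hxy, hRG x y hxy]

theorem BipartiteGraphClass.stable_of_isConstantCost {𝒢 : BipartiteGraphClass}
    (h : IsConstantCost 𝒢.equalityCost) : 𝒢.Stable := by
  obtain ⟨C, hC⟩ := h
  obtain ⟨K, hK⟩ := exists_chain_bound_of_oracleCost_le C
  refine ⟨K + 1, fun m n G hG => chainIndex_le_iff.2 fun hc => ?_⟩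
  obtain ⟨r, c, hrc⟩ := G.adjacency_ne_of_hasChain hc
  have h1 : oracleCost Equality G.adjacency ≤ 𝒢.equalityCost (m + n) :=
    le_iSup_of_le m (le_iSup_of_le n (le_iSup_of_le rfl (le_iSup₂_of_le G hG le_rfl)))
  have := hK G.adjacency (h1.trans (hC _)) r c hrc
  omega

theorem BipartiteGraphClass.isConstantCost_of_stable {𝒢 : BipartiteGraphClass}
    (hr : 𝒢.SignRankAtMost 3) (h : 𝒢.Stable) : IsConstantCost 𝒢.equalityCost := by
  obtain ⟨k, hk⟩ := h
  obtain ⟨d, hd⟩ := exists_eqComp_of_rank_le_three (4 * (k + 1))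
  refine ⟨d + 1, fun N => iSup_le fun m => iSup_le fun n => iSup_le fun _ =>
    iSup₂_le fun G hG => ?_⟩
  obtain ⟨R, hR, hRG⟩ := exists_of_signRank_le (d := 3) (hr m n G hG)
  have hRG' : (fun x y => 0 ≤ R x y) = G.Adj := by
    funext x y
    rw [hRG, G.adjacency_eq_one_iff]
  have hN := hd _ _ R hR fun hc =>
    chainIndex_le_iff.1 (hk m n G hG) (hasChain_toSimpleGraph (hRG' ▸ hc))
  exact oracleCost_le_of_eqComp (hN.congr fun x y => (hRG x y).symm)

end Classes

end SignRankGraphs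

theorem mainTheorem3 :
    (∀ 𝒢 : SignRankGraphs.GraphClass, 𝒢.SignRankAtMost 3 →
      (SignRankGraphs.IsConstantCost 𝒢.equalityCost ↔ 𝒢.Stable)) ∧
    (∀ 𝒢 : SignRankGraphs.BipartiteGraphClass, 𝒢.SignRankAtMost 3 →
      (SignRankGraphs.IsConstantCost 𝒢.equalityCost ↔ 𝒢.Stable)) :=
  ⟨fun _ hr => ⟨SignRankGraphs.GraphClass.stable_of_isConstantCost,
    SignRankGraphs.GraphClass.isConstantCost_of_stable hr⟩,
  fun _ hr => ⟨SignRankGraphs.BipartiteGraphClass.stable_of_isConstantCost,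
    SignRankGraphs.BipartiteGraphClass.isConstantCost_of_stable hr⟩⟩
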